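/- Let $(\Omega,\rho_\Omega)$ be a complete separable metric space with its Borel $\sigma$-algebra, $\mu$ a Borel probability measure on $\Omega$, $t_0<T$ and $u_{\min}<u_{\max}$ real numbers, $f_0,f_1:\mathbb R^n\times\Omega\to\mathbb R^n$, $g:\mathbb R^n\times\Omega\to\mathbb R$ and $\varphi:\Omega\to\mathbb R^n$. Write $f(x,u,\omega)=f_0(x,\omega)+u f_1(x,\omega)$ and $U=[u_{\min},u_{\max}]$. An admissible process $(u,\{x(\cdot,\omega)\}_{\omega\in\Omega})$ consists of a measurable $u:[t_0,T]\to\mathbb R$ with $u(t)\in U$ a.e. and arcs $x(\cdot,\omega)\in W^{1,1}([t_0,T];\mathbb R^n)$ with $x(t,\omega)=\varphi(\omega)+\int_{t_0}^t f(x(s,\omega),u(s),\omega)\,ds$ for all $t\in[t_0,T]$, $\omega\in\Omega$. Problem $(P)$ is to minimize $\int_\Omega g(x(T,\omega),\omega)\,d\mu(\omega)$ over admissible processes. (H0): $f_i(x,\cdot)$ is measurable for every $x$, and there are constants $c_i,k_i>0$ with $|f_i(x,\omega)|\le c_i(1+|x|)$ and $|f_i(x,\omega)-f_i(x',\omega)|\le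 k_i|x-x'|$ for all $x,x',\omega$ ($i=0,1$); $g$ is Borel measurable, bounded, and Lipschitz in $x$ uniformly in $\omega$. (H1), for a process $(\bar u,\bar x)$ and some $\delta>0$, with $B_t(\omega)$ the open ball of radius $\delta$ about $\bar x(t,\omega)$: (i) there is a nondecreasing $\theta:[0,\infty)\to[0,\infty)$ with $\theta(s)\to0$ as $s\to0^+$ and $\int_{t_0}^T\sup_{x\in B_t(\omega),\,u\in U}|f(x,u,\omega_1)-f(x,u,\omega_2)|\,dt\le\theta(\rho_\Omega(\omega_1,\omega_2))$ for all $\omega,\omega_1,\omega_2\in\Omega$; (ii) $g(\cdot,\omega)$ is continuously differentiable on $B_T(\omega)$ for every $\omega$; for every $x$, $\omega\mapsto\nabla_xg(x,\omega)$ is continuous on $\{\omega: x\in B_T(\omega)\}$; and $\nabla_xg(\bar x(T,\omega),\omega)$ is bounded in $\omega$; (iii) for all $\omega\in\Omega$, $u\in U$ and a.e. $t$, $f(\cdot,u,\omega)$ is continuously differentiable on $B_t(\omega)$; and for every $\omega_0$ and $\eta>0$ there is $r>0$ with $|\nabla_xf(x,u,\omega)-\nabla_xf(x,u,\omega_0)|\le\eta$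 whenever $\rho_\Omega(\omega,\omega_0)<r$, $t\in[t_0,T]$, $x\in B_t(\omega)\cap B_t(\omega_0)$, $u\in U$; (iv) for all $\omega\in\Omega$ and a.e. $t$, $f_0(\cdot,\omega)$ and $f_1(\cdot,\omega)$ are twice continuously differentiable on $B_t(\omega)$; and their first and second derivatives in $x$ at $(\bar x(t,\omega),\omega)$ are bounded by constants for all $\omega\in\operatorname{supp}\mu$ and a.e. $t$. Assume (H0) and (H1), and let $(\bar u,\bar x)$ and $p$ be as in one of the following two cases. (A) Known initial condition: $\varphi\equiv x_0$; $(\bar u,\bar x)$ is a $W^{1,1}$-local minimizer, i.e. for some $\epsilon>0$ its cost is at most that of every admissible process $(u,x)$ with $\|\bar x(\cdot,\omega)-x(\cdot,\omega)\|_{W^{1,1}([t_0,T];\mathbb R^n)}\le\epsilon$ for all $\omega\in\operatorname{supp}\mu$; and $p:[t_0,T]\times\Omega\to\mathbb R^n$ is the adjoint arc of the Pontryagin maximum principle: $p$ is measurable and, for every $\omega\in\operatorname{supp}\mu$, $p(\cdot,\omega)\in W^{1,1}$, $-\dot p(t,\omega)=[\nabla_xf(\bar x(t,\omega),\bar u(t),\omega)]^\top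 p(t,\omega)$ for a.e. $t$, and $-p(T,\omega)=\nabla_xg(\bar x(T,\omega),\omega)$. (B) Uncertain initial condition: $\varphi\in L^2(\mu,\Omega;\mathbb R^n)$; $(\bar u,\bar x)$ is a $W^{1,1}$-local minimizer for the $L^2$-valued state, i.e. for some $\epsilon>0$ its cost is at most that of every admissible process $(u,x)$ with $\|\bar x-x\|_{W^{1,1}([t_0,T];L^2(\mu,\Omega;\mathbb R^n))}\le\epsilon$ (for instance a global minimizer); and $p\in W^{1,1}([t_0,T];L^2(\mu,\Omega;\mathbb R^n))$ is the adjoint arc, the solution in $L^2$ of $-\dot p(t)=\big(\tfrac{\partial f}{\partial x}(\bar x(t),\bar u(t))\big)^*p(t)$ for a.e. $t$, $-p(T)=\nabla_xg(\bar x(T,\cdot),\cdot)$. Let $\Psi(t)=\int_\Omega p(t,\omega)\cdot f_1(\bar x(t,\omega),\omega)\,d\mu(\omega)$ for $t\in[t_0,T]$ (the integrand is integrable). Then, for a.e. $t\in[t_0,T]$, $\bar u(t)=u_{\max}$ if $\Psi(t)>0$ and $\bar u(t)=u_{\min}$ if $\Psi(t)<0$. Moreover, on every open interval $(a,b)\subset[t_0,T]$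 on which $\Psi=0$, for a.e. $t\in(a,b)$, $$\int_\Omega p\cdot[f_0,[f_0,f_1]]\,d\mu(\omega)+\bar u(t)\int_\Omega p\cdot[f_1,[f_0,f_1]]\,d\mu(\omega)=0,$$ where both integrands are integrable, $p$ is taken at $(t,\omega)$ and the brackets at $(\bar x(t,\omega),\omega)$, and $[v,w]=w'v-v'w$ is the Lie bracket in $x$. -/

import Mathlib

open MeasureTheory Filter Topology Set
open scoped ENNReal

/-- The state space `ℝⁿ` with its Euclidean norm. -/
abbrev StateSpace (n : ℕ) : Type := EuclideanSpace ℝ (Fin n)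

/-- The data of the averaged control-affine problem `(P)` with a scalar control:
minimize `∫ g (x(T,ω), ω) dμ(ω)` subject to `ẋ = f₀(x,ω) + u(t) f₁(x,ω)` on `[t₀, T]`,
`x(t₀,ω) = φ(ω)` and `u(t) ∈ [umin, umax]`. -/
structure AffineProblem (n : ℕ) (Ω : Type*) where
  t₀ : ℝ
  T : ℝ
  umin : ℝ
  umax : ℝ
  f₀ : StateSpace n → Ω → StateSpace n
  f₁ : StateSpace n → Ω → StateSpace n
  g : StateSpace n → Ω → ℝ
  φ : Ω → StateSpace n
  time_lt : t₀ < T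
  control_lt : umin < umax

/-- `z` belongs to `W^{1,1}([a,b]; X)` (continuous representative) and `v` is a version of its
derivative. -/
def HasW11Deriv {X : Type*} [NormedAddCommGroup X] [NormedSpace ℝ X]
    (a b : ℝ) (z v : ℝ → X) : Prop :=
  IntervalIntegrable v volume a b ∧ ∀ t ∈ Icc a b, z t = z a + ∫ s in a..t, v s

/-- The norm `‖z‖₁ + ‖ż‖₁` of `W^{1,1}([a,b]; X)`, with values in `[0,∞]`. -/
noncomputable def w11Norm {X : Type*} [NormedAddCommGroup X] [NormedSpace ℝ X]
    (a b : ℝ) (z : ℝ → X) : ℝ≥0∞ :=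
  (∫⁻ t in Icc a b, ‖z t‖ₑ) + ∫⁻ t in Icc a b, ‖deriv z t‖ₑ

/-- The norm of `W^{1,1}([a,b]; L²(μ; ℝⁿ))`, with values in `[0,∞]`, of the curve represented by
the family of arcs `t ↦ z t ω`. -/
noncomputable def w11L2Norm {n : ℕ} {Ω : Type*} [MeasurableSpace Ω] (μ : Measure Ω)
    (a b : ℝ) (z : ℝ → Ω → StateSpace n) : ℝ≥0∞ :=
  (∫⁻ t in Icc a b, eLpNorm (z t) 2 μ) +
    ∫⁻ t in Icc a b, eLpNorm (fun ω => deriv (fun s => z s ω) t) 2 μ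

namespace AffineProblem

variable {n : ℕ} {Ω : Type*}

/-- The dynamics `f(x,u,ω) = f₀(x,ω) + u f₁(x,ω)`. -/
def dyn (P : AffineProblem n Ω) (x : StateSpace n) (u : ℝ) (ω : Ω) : StateSpace n :=
  P.f₀ x ω + u • P.f₁ x ω

/-- The Jacobian `∂f/∂x (x,u,ω)`. -/
noncomputable def dynJac (P : AffineProblem n Ω) (x : StateSpace n) (u : ℝ) (ω : Ω) :
    StateSpace n →L[ℝ] StateSpace n :=
  fderiv ℝ (fun y => P.dyn y u ω) x

/-- Admissible controls: measurable, with values in `[umin, umax]` almost everywhere. -/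
def IsAdmissibleControl (P : AffineProblem n Ω) (u : ℝ → ℝ) : Prop :=
  AEStronglyMeasurable u (volume.restrict (Icc P.t₀ P.T)) ∧
    ∀ᵐ t ∂volume.restrict (Icc P.t₀ P.T), u t ∈ Icc P.umin P.umax

/-- Admissible processes: an admissible control with the family of arcs `x(·,ω) ∈ W^{1,1}` that
solve `x(t,ω) = φ(ω) + ∫_{t₀}^t f(x(s,ω),u(s),ω) ds`, for each `ω`. -/
def IsAdmissible (P : AffineProblem n Ω) (u : ℝ → ℝ) (x : ℝ → Ω → StateSpace n) : Prop :=
  P.IsAdmissibleControl u ∧ ∀ ω, x P.t₀ ω = P.φ ω ∧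
    HasW11Deriv P.t₀ P.T (fun t => x t ω) (fun t => P.dyn (x t ω) (u t) ω)

variable [MetricSpace Ω] [MeasurableSpace Ω]

/-- The averaged cost. -/
noncomputable def cost (P : AffineProblem n Ω) (μ : Measure Ω) (x : ℝ → Ω → StateSpace n) : ℝ :=
  ∫ ω, P.g (x P.T ω) ω ∂μ

/-- `W^{1,1}`-local minimizer: optimal among all admissible processes whose arcs are
`ε`-close in `W^{1,1}([t₀,T]; ℝⁿ)` for every `ω` in the support of `μ`. -/
def IsW11LocalMin (P : AffineProblem n Ω) (μ : Measure Ω) (u : ℝ → ℝ)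
    (x : ℝ → Ω → StateSpace n) : Prop :=
  P.IsAdmissible u x ∧ ∃ ε : ℝ, 0 < ε ∧ ∀ (v : ℝ → ℝ) (y : ℝ → Ω → StateSpace n),
    P.IsAdmissible v y →
    (∀ ω ∈ μ.support, w11Norm P.t₀ P.T (fun t => x t ω - y t ω) ≤ ENNReal.ofReal ε) →
    P.cost μ x ≤ P.cost μ y

/-- `W^{1,1}`-local minimizer when the state is regarded as a curve in `L²(μ; ℝⁿ)`: optimal among
all admissible processes that are `ε`-close in `W^{1,1}([t₀,T]; L²(μ; ℝⁿ))`. Every (global)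
minimizer is one. -/
def IsW11LocalMinL2 (P : AffineProblem n Ω) (μ : Measure Ω) (u : ℝ → ℝ)
    (x : ℝ → Ω → StateSpace n) : Prop :=
  P.IsAdmissible u x ∧ ∃ ε : ℝ, 0 < ε ∧ ∀ (v : ℝ → ℝ) (y : ℝ → Ω → StateSpace n),
    P.IsAdmissible v y →
    w11L2Norm μ P.t₀ P.T (fun t ω => x t ω - y t ω) ≤ ENNReal.ofReal ε →
    P.cost μ x ≤ P.cost μ y

/-- Assumptions (H0) on the data. -/
structure H0 (P : AffineProblem n Ω) : Prop where
  meas_f₀ : ∀ x, Measurable (P.f₀ x)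
  meas_f₁ : ∀ x, Measurable (P.f₁ x)
  growth_f₀ : ∃ c : ℝ, 0 < c ∧ ∀ x ω, ‖P.f₀ x ω‖ ≤ c * (1 + ‖x‖)
  growth_f₁ : ∃ c : ℝ, 0 < c ∧ ∀ x ω, ‖P.f₁ x ω‖ ≤ c * (1 + ‖x‖)
  lip_f₀ : ∃ k : ℝ, 0 < k ∧ ∀ x y ω, ‖P.f₀ x ω - P.f₀ y ω‖ ≤ k * ‖x - y‖
  lip_f₁ : ∃ k : ℝ, 0 < k ∧ ∀ x y ω, ‖P.f₁ x ω - P.f₁ y ω‖ ≤ k * ‖x - y‖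
  meas_g : Measurable (fun z : StateSpace n × Ω => P.g z.1 z.2)
  bound_g : ∃ M : ℝ, 0 < M ∧ ∀ x ω, |P.g x ω| ≤ M
  lip_g : ∃ k : ℝ, 1 ≤ k ∧ ∀ x y ω, |P.g x ω - P.g y ω| ≤ k * ‖x - y‖

/-- Assumptions (H1), relative to a family of arcs `x` and a radius `δ > 0`. Continuity in `ω` of
a derivative at a fixed point is asked only where that point lies in the `δ`-tube on which
differentiability is assumed. -/
structure H1 (P : AffineProblem n Ω) (μ : Measure Ω) (x : ℝ → Ω → StateSpace n) (δ : ℝ) :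
    Prop where
  modulus : ∃ θ : ℝ → ℝ, (∀ s, 0 ≤ s → 0 ≤ θ s) ∧ MonotoneOn θ (Ici 0) ∧
    Tendsto θ (𝓝[>] 0) (𝓝 0) ∧
    ∀ ω ω₁ ω₂ : Ω,
      ∫⁻ t in Icc P.t₀ P.T, (⨆ y ∈ Metric.ball (x t ω) δ, ⨆ u ∈ Icc P.umin P.umax,
        ‖P.dyn y u ω₁ - P.dyn y u ω₂‖ₑ) ≤ ENNReal.ofReal (θ (dist ω₁ ω₂))
  diff_g : ∀ ω, DifferentiableOn ℝ (fun y => P.g y ω) (Metric.ball (x P.T ω) δ)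
  cont_grad_g : ∀ ω, ContinuousOn (gradient (fun y => P.g y ω)) (Metric.ball (x P.T ω) δ)
  cont_grad_g_param : ∀ y : StateSpace n,
    ContinuousOn (fun ω => gradient (fun z => P.g z ω) y) {ω | y ∈ Metric.ball (x P.T ω) δ}
  bound_grad_g : ∃ C : ℝ, 0 < C ∧ ∀ ω, ‖gradient (fun y => P.g y ω) (x P.T ω)‖ ≤ C
  c1_dyn : ∀ ω, ∀ u ∈ Icc P.umin P.umax, ∀ᵐ t ∂volume.restrict (Icc P.t₀ P.T),
    ContDiffOn ℝ 1 (fun y => P.dyn y u ω) (Metric.ball (x t ω) δ)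
  cont_jac_param : ∀ ω₀ : Ω, ∀ η : ℝ, 0 < η → ∃ r : ℝ, 0 < r ∧ ∀ ω, dist ω ω₀ < r →
    ∀ t ∈ Icc P.t₀ P.T, ∀ y ∈ Metric.ball (x t ω) δ ∩ Metric.ball (x t ω₀) δ,
      ∀ u ∈ Icc P.umin P.umax, ‖P.dynJac y u ω - P.dynJac y u ω₀‖ ≤ η
  c2_f₀ : ∀ ω, ∀ᵐ t ∂volume.restrict (Icc P.t₀ P.T),
    ContDiffOn ℝ 2 (fun y => P.f₀ y ω) (Metric.ball (x t ω) δ)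
  c2_f₁ : ∀ ω, ∀ᵐ t ∂volume.restrict (Icc P.t₀ P.T),
    ContDiffOn ℝ 2 (fun y => P.f₁ y ω) (Metric.ball (x t ω) δ)
  bound_f₀ : ∃ C₁ C₂ : ℝ, 0 < C₁ ∧ 0 < C₂ ∧ ∀ ω ∈ μ.support,
    ∀ᵐ t ∂volume.restrict (Icc P.t₀ P.T),
      ‖fderiv ℝ (fun y => P.f₀ y ω) (x t ω)‖ < C₁ ∧
      ‖fderiv ℝ (fderiv ℝ (fun y => P.f₀ y ω)) (x t ω)‖ < C₂
  bound_f₁ : ∃ C₁ C₂ : ℝ, 0 < C₁ ∧ 0 < C₂ ∧ ∀ ω ∈ μ.support,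
    ∀ᵐ t ∂volume.restrict (Icc P.t₀ P.T),
      ‖fderiv ℝ (fun y => P.f₁ y ω) (x t ω)‖ < C₁ ∧
      ‖fderiv ℝ (fderiv ℝ (fun y => P.f₁ y ω)) (x t ω)‖ < C₂

/-- The adjoint arc of the maximum principle for a known initial state: a jointly measurable `p`
with `p(·,ω) ∈ W^{1,1}`, `-ṗ = (∂f/∂x)ᵀ p` and `-p(T,ω) = ∇ₓ g(x(T,ω),ω)` for every `ω` in the
support of `μ`. The maximum condition is not part of the definition. -/
structure IsCostate (P : AffineProblem n Ω) (μ : Measure Ω) (u : ℝ → ℝ)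
    (x p : ℝ → Ω → StateSpace n) : Prop where
  meas : AEStronglyMeasurable (fun z : ℝ × Ω => p z.1 z.2)
    ((volume.restrict (Icc P.t₀ P.T)).prod μ)
  adjoint_eq : ∀ ω ∈ μ.support, HasW11Deriv P.t₀ P.T (fun t => p t ω)
    (fun t => -(ContinuousLinearMap.adjoint (P.dynJac (x t ω) (u t) ω)) (p t ω))
  terminal : ∀ ω ∈ μ.support, -p P.T ω = gradient (fun y => P.g y ω) (x P.T ω)

/-- The adjoint arc of the maximum principle for an uncertain initial state: the solution
`p ∈ W^{1,1}([t₀,T]; L²(μ; ℝⁿ))` of `-ṗ = (∂f/∂x)^* p`, `-p(T) = ∇ₓ g(x(T,·),·)`, the operator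
being the multiplication by the transposed Jacobian. The maximum condition is not part of the
definition. -/
structure IsCostateL2 (P : AffineProblem n Ω) (μ : Measure Ω) (u : ℝ → ℝ)
    (x : ℝ → Ω → StateSpace n) (p : ℝ → Lp (StateSpace n) 2 μ) : Prop where
  adjoint_eq : ∃ p' : ℝ → Lp (StateSpace n) 2 μ, HasW11Deriv P.t₀ P.T p p' ∧
    ∀ᵐ t ∂volume.restrict (Icc P.t₀ P.T), ∀ᵐ ω ∂μ,
      -(p' t) ω = (ContinuousLinearMap.adjoint (P.dynJac (x t ω) (u t) ω)) (p t ω)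
  terminal : ∀ᵐ ω ∂μ, -(p P.T) ω = gradient (fun y => P.g y ω) (x P.T ω)

/-- The switching function `Ψ(t) = ∫ p(t,ω) · f₁(x(t,ω),ω) dμ(ω)`. -/
noncomputable def switching (P : AffineProblem n Ω) (μ : Measure Ω)
    (x p : ℝ → Ω → StateSpace n) (t : ℝ) : ℝ :=
  ∫ ω, inner ℝ (p t ω) (P.f₁ (x t ω) ω) ∂μ

/-- The integrand `p · [f₀,[f₀,f₁]]` along `(x,p)`;
`VectorField.lieBracket` is `[V,W] = W'V - V'W`. -/
noncomputable def bracket₀ (P : AffineProblem n Ω) (x p : ℝ → Ω → StateSpace n) (t : ℝ)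
    (ω : Ω) : ℝ :=
  inner ℝ (p t ω) (VectorField.lieBracket ℝ (fun y => P.f₀ y ω)
    (VectorField.lieBracket ℝ (fun y => P.f₀ y ω) (fun y => P.f₁ y ω)) (x t ω))

/-- The integrand `p · [f₁,[f₀,f₁]]` along `(x,p)`. -/
noncomputable def bracket₁ (P : AffineProblem n Ω) (x p : ℝ → Ω → StateSpace n) (t : ℝ)
    (ω : Ω) : ℝ :=
  inner ℝ (p t ω) (VectorField.lieBracket ℝ (fun y => P.f₁ y ω)
    (VectorField.lieBracket ℝ (fun y => P.f₀ y ω) (fun y => P.f₁ y ω)) (x t ω))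

/-- The characterization of the control `u` along `(x,p)`: bang-bang where `Ψ ≠ 0`, and the
singular-arc equation on every open interval where `Ψ = 0`; all integrals exist. -/
structure ControlCharacterization (P : AffineProblem n Ω) (μ : Measure Ω) (u : ℝ → ℝ)
    (x p : ℝ → Ω → StateSpace n) : Prop where
  switching_integrable : ∀ t ∈ Icc P.t₀ P.T,
    Integrable (fun ω => inner ℝ (p t ω) (P.f₁ (x t ω) ω)) μ
  bang : ∀ᵐ t ∂volume.restrict (Icc P.t₀ P.T),
    (0 < P.switching μ x p t → u t = P.umax) ∧ (P.switching μ x p t < 0 → u t = P.umin)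
  singular : ∀ a b : ℝ, Ioo a b ⊆ Icc P.t₀ P.T →
    (∀ t ∈ Ioo a b, P.switching μ x p t = 0) →
    ∀ᵐ t ∂volume.restrict (Ioo a b),
      Integrable (P.bracket₀ x p t) μ ∧ Integrable (P.bracket₁ x p t) μ ∧
      (∫ ω, P.bracket₀ x p t ω ∂μ) + u t * (∫ ω, P.bracket₁ x p t ω ∂μ) = 0

end AffineProblem

/-! The set of controls is an interval and the dynamics are affine in the control, so convex
variations `w + ε (v - w)` suffice and needle variations are not needed. After altering the control
on a null set it is a Borel `w` with values in the interval everywhere. Arcs depend on the control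
in a Lipschitz way, with a constant proportional to `1 + ‖φ ω‖` (`UniformBounds.exists_stability`).
Hence either notion of local minimality gives optimality among uniformly close controls
(`IsUniformLocalMin`), and both cases are treated together from there on.

Solving the adjoint equation for each parameter separately gives a bounded measurable `q`
(`exists_isBoundedCostate`). Pairing `q` with the variation of the state cancels the linear part of
the dynamics. Dominated convergence in the cost quotient then yields `∫ (v - w) Ψ ≤ 0` for every `v`
(`IsUniformLocalMin.integral_le_zero`). Taking for `v` the bang-bang control prescribed by the sign
of `Ψ` makes the integrand nonnegative, hence zero almost everywhere.

For a singular arc, the derivative of the average of `q · h` is the average of `q · [f₀,h]` plus `w`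
times that of `q · [f₁,h]` (`hasW11Deriv_avg`). With `h = f₁` the control drops out, since `[f₁,f₁]
= 0`, so the average of `q · [f₀,f₁]` vanishes on the interval. Differentiating once more gives the
equation. The double brackets grow at most quadratically in `1 + ‖φ ω‖`, which is integrable exactly
because `φ` is in `L²`.

The given adjoint arc `p` is finally identified with `q`: pathwise on the support of `μ` in the
first case, and as `L²` classes in the second. Both identifications are backward Grönwall arguments.
-/

/-- Grönwall's inequality in integral form. -/
theorem le_mul_exp_of_le_add_integral {a b K c : ℝ} {f : ℝ → ℝ} (hK : 0 ≤ K)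
    (hf : ContinuousOn f (Icc a b))
    (h : ∀ t ∈ Icc a b, f t ≤ c + K * ∫ s in a..t, f s) :
    ∀ t ∈ Icc a b, f t ≤ c * Real.exp (K * (t - a)) := by
  intro t ht
  have hab : a ≤ b := ht.1.trans ht.2
  -- Integrating factor times the right-hand side of the hypothesis; the hypothesis says precisely
  -- that its derivative is nonpositive.
  set W : ℝ → ℝ := fun t => Real.exp (-(K * (t - a))) * (c + K * ∫ s in a..t, f s) with hW
  have hint : IntegrableOn f (uIcc a b) := by
    rw [uIcc_of_le hab]; exact hf.integrableOn_Icc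
  have hcont : ContinuousOn W (Icc a b) := by
    have := intervalIntegral.continuousOn_primitive_interval hint
    rw [uIcc_of_le hab] at this
    exact ContinuousOn.mul (by fun_prop) (continuousOn_const.add (continuousOn_const.mul this))
  have hder : ∀ t ∈ Ioo a b, HasDerivAt W
      (Real.exp (-(K * (t - a))) * (-K) * (c + K * ∫ s in a..t, f s) +
        Real.exp (-(K * (t - a))) * (K * f t)) t := by
    intro t ht
    have h1 : HasDerivAt (fun t => ∫ s in a..t, f s) (f t) t := by
      refine intervalIntegral.integral_hasDerivAt_right ?_ ?_ ?_
      · exact (hf.mono (Icc_subset_Icc_right ht.2.le)).intervalIntegrable_of_Icc ht.1.le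
      · exact (hf.mono Ioo_subset_Icc_self).stronglyMeasurableAtFilter isOpen_Ioo t ht
      · exact hf.continuousAt (Icc_mem_nhds ht.1 ht.2)
    have h2 : HasDerivAt (fun t => Real.exp (-(K * (t - a)))) (Real.exp (-(K * (t - a))) * (-K))
        t := by
      have : HasDerivAt (fun t => -(K * (t - a))) (-K) t := by
        have := (((hasDerivAt_id t).sub_const a).const_mul K).neg
        rw [mul_one] at this
        exact this
      exact this.exp
    exact h2.mul ((h1.const_mul K).const_add c)
  have hanti : AntitoneOn W (Icc a b) := by
    refine antitoneOn_of_deriv_nonpos (convex_Icc a b) hcont ?_ ?_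
    · rw [interior_Icc]
      exact fun t ht => (hder t ht).differentiableAt.differentiableWithinAt
    · rw [interior_Icc]
      intro t ht
      rw [(hder t ht).deriv]
      have := mul_nonneg (mul_nonneg hK (Real.exp_pos (-(K * (t - a)))).le)
        (sub_nonneg.2 (h t (Ioo_subset_Icc_self ht)))
      nlinarith
  have h3 := hanti (left_mem_Icc.2 hab) ht ht.1
  simp only [hW, sub_self, mul_zero, neg_zero, Real.exp_zero, one_mul,
    intervalIntegral.integral_same, add_zero] at h3
  rw [Real.exp_neg, inv_mul_le_iff₀ (Real.exp_pos _)] at h3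
  linarith [h t ht]

/-! ### Calculus of `W^{1,1}` arcs -/

section W11

variable {X : Type*} [NormedAddCommGroup X] [NormedSpace ℝ X] {a b : ℝ} {z v : ℝ → X}

theorem HasW11Deriv.intervalIntegrable_sub (h : HasW11Deriv a b z v) {s t : ℝ}
    (hs : s ∈ Icc a b) (ht : t ∈ Icc a b) : IntervalIntegrable v volume s t := by
  refine h.1.mono_set ?_
  rw [uIcc_of_le (hs.1.trans hs.2)]
  exact uIcc_subset_Icc hs ht

theorem HasW11Deriv.sub_eq (h : HasW11Deriv a b z v) {s t : ℝ}
    (hs : s ∈ Icc a b) (ht : t ∈ Icc a b) : z t - z s = ∫ r in s..t, v r := by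
  have ha : a ∈ Icc a b := left_mem_Icc.2 (hs.1.trans hs.2)
  rw [h.2 t ht, h.2 s hs, add_sub_add_left_eq_sub]
  exact intervalIntegral.integral_interval_sub_left (h.intervalIntegrable_sub ha ht)
    (h.intervalIntegrable_sub ha hs)

theorem HasW11Deriv.congr_ae {v' : ℝ → X} (h : HasW11Deriv a b z v) (hab : a ≤ b)
    (hv : v =ᵐ[volume.restrict (Icc a b)] v') : HasW11Deriv a b z v' := by
  have hv' : v =ᵐ[volume.restrict (Ioc a b)] v' :=
    ae_restrict_of_ae_restrict_of_subset Ioc_subset_Icc_self hv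
  refine ⟨h.1.congr_ae (by rwa [uIoc_of_le hab]), fun t ht => ?_⟩
  rw [h.2 t ht]
  congr 1
  refine intervalIntegral.integral_congr_ae_restrict ?_
  rw [uIoc_of_le ht.1]
  exact ae_restrict_of_ae_restrict_of_subset (Ioc_subset_Ioc_right ht.2) hv'

theorem HasW11Deriv.sub {w r : ℝ → X} (h : HasW11Deriv a b z v) (h' : HasW11Deriv a b w r) :
    HasW11Deriv a b (fun t => z t - w t) (fun t => v t - r t) := by
  refine ⟨h.1.sub h'.1, fun t ht => ?_⟩
  have ha : a ∈ Icc a b := left_mem_Icc.2 (ht.1.trans ht.2)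
  beta_reduce
  rw [intervalIntegral.integral_sub (h.intervalIntegrable_sub ha ht)
    (h'.intervalIntegrable_sub ha ht), h.2 t ht, h'.2 t ht]
  abel

theorem HasW11Deriv.continuousOn (h : HasW11Deriv a b z v) : ContinuousOn z (Icc a b) := by
  rcases le_or_gt a b with hab | hab
  · have h1 : IntegrableOn v (uIcc a b) := by
      rw [uIcc_of_le hab, integrableOn_Icc_iff_integrableOn_Ioc]
      exact (intervalIntegrable_iff_integrableOn_Ioc_of_le hab).1 h.1
    have h2 := intervalIntegral.continuousOn_primitive_interval h1
    rw [uIcc_of_le hab] at h2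
    exact (continuousOn_const.add h2).congr h.2
  · rw [Icc_eq_empty hab.not_ge]; exact continuousOn_empty z

theorem HasW11Deriv.norm_sub_le {C : ℝ} (h : HasW11Deriv a b z v)
    (hC : ∀ t ∈ Icc a b, ‖v t‖ ≤ C) {s t : ℝ} (hs : s ∈ Icc a b) (ht : t ∈ Icc a b) :
    ‖z t - z s‖ ≤ C * |t - s| := by
  rw [h.sub_eq hs ht]
  refine intervalIntegral.norm_integral_le_of_norm_le_const fun r hr => hC r ?_
  exact uIcc_subset_Icc hs ht (uIoc_subset_uIcc hr)

theorem HasW11Deriv.ae_hasDerivAt [CompleteSpace X] (h : HasW11Deriv a b z v) :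
    ∀ᵐ t, t ∈ Ioo a b → HasDerivAt z (v t) t := by
  filter_upwards [h.1.ae_hasDerivAt_integral] with t ht htab
  have hab : a ≤ b := (htab.1.trans htab.2).le
  rw [uIcc_of_le hab] at ht
  refine ((ht (Ioo_subset_Icc_self htab) a (left_mem_Icc.2 hab)).const_add (z a)).congr_of_eventuallyEq ?_
  filter_upwards [Icc_mem_nhds htab.1 htab.2] with s hs using h.2 s hs

theorem HasW11Deriv.prodMk {Y : Type*} [NormedAddCommGroup Y] [NormedSpace ℝ Y]
    [CompleteSpace X] [CompleteSpace Y] {w r : ℝ → Y}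
    (h : HasW11Deriv a b z v) (h' : HasW11Deriv a b w r) :
    HasW11Deriv a b (fun t => (z t, w t)) (fun t => (v t, r t)) := by
  refine ⟨⟨h.1.1.prodMk h'.1.1, h.1.2.prodMk h'.1.2⟩, fun t ht => ?_⟩
  have ha : a ∈ Icc a b := left_mem_Icc.2 (ht.1.trans ht.2)
  have hi := h.intervalIntegrable_sub ha ht
  have hi' := h'.intervalIntegrable_sub ha ht
  have hp : IntervalIntegrable (fun t => (v t, r t)) volume a t :=
    ⟨hi.1.prodMk hi'.1, hi.2.prodMk hi'.2⟩
  have h1 := (ContinuousLinearMap.fst ℝ X Y).intervalIntegral_comp_comm hp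
  have h2 := (ContinuousLinearMap.snd ℝ X Y).intervalIntegral_comp_comm hp
  simp only [ContinuousLinearMap.coe_fst', ContinuousLinearMap.coe_snd'] at h1 h2
  ext1
  · simp only [Prod.fst_add, ← h1]; exact h.2 t ht
  · simp only [Prod.snd_add, ← h2]; exact h'.2 t ht

/-- The chain rule for a `C¹` function of an arc with bounded velocity. -/
theorem HasW11Deriv.contDiff_comp [CompleteSpace X] {C : ℝ} {F : X → ℝ}
    (h : HasW11Deriv a b z v) (hab : a ≤ b) (hC : ∀ t ∈ Icc a b, ‖v t‖ ≤ C)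
    (hF : ∀ t ∈ Icc a b, ContDiffAt ℝ 1 F (z t)) :
    HasW11Deriv a b (fun t => F (z t)) (fun t => fderiv ℝ F (z t) (v t)) := by
  -- `F` is Lipschitz on the compact image of the arc, and the bounded velocity makes the arc
  -- Lipschitz. The composition is then absolutely continuous, hence the integral of its almost
  -- everywhere derivative.
  have hLip : ∃ K, LipschitzOnWith K (fun t => F (z t)) (Icc a b) := by
    have hK : LocallyLipschitzOn (z '' Icc a b) F := by
      rintro _ ⟨t, ht, rfl⟩
      obtain ⟨K, s, hs, hK⟩ := (hF t ht).exists_lipschitzOnWith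
      exact ⟨K, s, mem_nhdsWithin_of_mem_nhds hs, hK⟩
    obtain ⟨K, hK⟩ := hK.exists_lipschitzOnWith_of_compact
      (isCompact_Icc.image_of_continuousOn h.continuousOn)
    have hz : LipschitzOnWith C.toNNReal z (Icc a b) := by
      refine LipschitzOnWith.of_dist_le_mul fun s hs t ht => ?_
      rw [dist_eq_norm, dist_eq_norm]
      refine (h.norm_sub_le hC ht hs).trans ?_
      exact mul_le_mul_of_nonneg_right (Real.le_coe_toNNReal C) (abs_nonneg _)
    exact ⟨_, hK.comp hz (mapsTo_image _ _)⟩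
  obtain ⟨K, hK⟩ := hLip
  have hac : ∀ t ∈ Icc a b, AbsolutelyContinuousOnInterval (fun t => F (z t)) a t := fun t ht =>
    LipschitzOnWith.absolutelyContinuousOnInterval (K := K)
      (hK.mono (uIcc_subset_Icc (left_mem_Icc.2 hab) ht))
  have hd : ∀ᵐ t ∂volume.restrict (Icc a b),
      deriv (fun t => F (z t)) t = fderiv ℝ F (z t) (v t) := by
    rw [← restrict_Ioo_eq_restrict_Icc, ae_restrict_iff' measurableSet_Ioo]
    filter_upwards [h.ae_hasDerivAt] with t ht htab
    exact (((hF t (Ioo_subset_Icc_self htab)).differentiableAt one_ne_zero).hasFDerivAt.comp_hasDerivAt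
      t (ht htab)).deriv
  refine HasW11Deriv.congr_ae (v := deriv (fun t => F (z t))) ⟨?_, fun t ht => ?_⟩ hab hd
  · exact (hac b (right_mem_Icc.2 hab)).intervalIntegrable_deriv
  · rw [(hac t ht).integral_deriv_eq_sub]; ring

end W11

/-! ### Picard iteration and Grönwall estimates for Carathéodory equations -/

section Picard

variable {X : Type*} [NormedAddCommGroup X] [NormedSpace ℝ X]

/-- The Picard iterates of the integral equation `x(t) = x₀ + ∫_a^t G(s, x(s)) ds`. -/
noncomputable def picardIterate (a : ℝ) (G : ℝ → X → X) (x₀ : X) : ℕ → ℝ → X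
  | 0 => fun _ => x₀
  | k + 1 => fun t => x₀ + ∫ s in a..t, G s (picardIterate a G x₀ k s)

variable {a b K : ℝ} {G : ℝ → X → X} {x₀ : X}

theorem hasW11Deriv_picardIterate_succ
    (hint : ∀ y : ℝ → X, ContinuousOn y (Icc a b) →
      IntervalIntegrable (fun s => G s (y s)) volume a b) (k : ℕ) :
    HasW11Deriv a b (picardIterate a G x₀ (k + 1))
      (fun s => G s (picardIterate a G x₀ k s)) := by
  induction k with
  | zero =>
    exact ⟨hint _ continuousOn_const, fun t _ => by simp [picardIterate]⟩
  | succ k ih =>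
    exact ⟨hint _ ih.continuousOn, fun t _ => by
      rw [picardIterate]; simp [picardIterate]⟩

theorem continuousOn_picardIterate
    (hint : ∀ y : ℝ → X, ContinuousOn y (Icc a b) →
      IntervalIntegrable (fun s => G s (y s)) volume a b) (k : ℕ) :
    ContinuousOn (picardIterate a G x₀ k) (Icc a b) := by
  cases k with
  | zero => exact continuousOn_const
  | succ k => exact (hasW11Deriv_picardIterate_succ hint k).continuousOn

theorem integral_pow_div_factorial (a t K C : ℝ) (k : ℕ) :
    ∫ s in a..t, K * (C * ((K * (s - a)) ^ k / k.factorial)) =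
      C * ((K * (t - a)) ^ (k + 1) / (k + 1).factorial) := by
  have hd : ∀ s ∈ uIcc a t, HasDerivAt
      (fun s => C * ((K * (s - a)) ^ (k + 1) / (k + 1).factorial))
      (K * (C * ((K * (s - a)) ^ k / k.factorial))) s := by
    intro s _
    have h1 : HasDerivAt (fun s => K * (s - a)) K s := by
      have := ((hasDerivAt_id s).sub_const a).const_mul K
      rw [mul_one] at this
      exact this
    have h2 := ((h1.pow (k + 1)).div_const ((k + 1).factorial : ℝ)).const_mul C
    refine HasDerivAt.congr_deriv h2 ?_
    have : (k.factorial : ℝ) ≠ 0 := by positivity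
    have h3 : (((k + 1 : ℕ) : ℝ)) ≠ 0 := by positivity
    rw [Nat.factorial_succ, Nat.cast_mul, Nat.add_sub_cancel]
    field_simp
  rw [intervalIntegral.integral_eq_sub_of_hasDerivAt hd
    (Continuous.intervalIntegrable (by fun_prop) _ _)]
  simp

/-- Each integration gains a factor `K (t - a) / (k + 1)`. The increments are therefore summable on
the whole interval, whatever its length. -/
theorem norm_picardIterate_succ_sub_le
    (hint : ∀ y : ℝ → X, ContinuousOn y (Icc a b) →
      IntervalIntegrable (fun s => G s (y s)) volume a b)
    (hlip : ∀ s ∈ Icc a b, ∀ x y, ‖G s x - G s y‖ ≤ K * ‖x - y‖) (hK : 0 ≤ K) {C : ℝ}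
    (hC : ∀ t ∈ Icc a b, ‖picardIterate a G x₀ 1 t - x₀‖ ≤ C) (k : ℕ) :
    ∀ t ∈ Icc a b, ‖picardIterate a G x₀ (k + 1) t - picardIterate a G x₀ k t‖ ≤
      C * ((K * (t - a)) ^ k / k.factorial) := by
  induction k with
  | zero => intro t ht; simpa [picardIterate] using hC t ht
  | succ k ih =>
    intro t ht
    have ha : a ∈ Icc a b := left_mem_Icc.2 (ht.1.trans ht.2)
    have h1 := hasW11Deriv_picardIterate_succ (x₀ := x₀) hint (k + 1)
    have h0 := hasW11Deriv_picardIterate_succ (x₀ := x₀) hint k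
    have e : picardIterate a G x₀ (k + 1 + 1) t - picardIterate a G x₀ (k + 1) t =
        ∫ s in a..t, (G s (picardIterate a G x₀ (k + 1) s) - G s (picardIterate a G x₀ k s)) := by
      rw [intervalIntegral.integral_sub (h1.intervalIntegrable_sub ha ht)
        (h0.intervalIntegrable_sub ha ht)]
      simp [picardIterate]
    rw [e, ← integral_pow_div_factorial]
    refine intervalIntegral.norm_integral_le_of_norm_le ht.1 (ae_of_all _ fun s hs => ?_)
      (Continuous.intervalIntegrable (by fun_prop) _ _)
    have hs' : s ∈ Icc a b := ⟨hs.1.le, hs.2.trans ht.2⟩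
    exact (hlip s hs' _ _).trans (mul_le_mul_of_nonneg_left (ih s hs') hK)

/-- Global existence for the Carathéodory equation with a Lipschitz right-hand side; the Picard
iterates converge to the solution. -/
theorem exists_hasW11Deriv_tendsto_picardIterate [CompleteSpace X] (hab : a ≤ b)
    (hint : ∀ y : ℝ → X, ContinuousOn y (Icc a b) →
      IntervalIntegrable (fun s => G s (y s)) volume a b)
    (hlip : ∀ s ∈ Icc a b, ∀ x y, ‖G s x - G s y‖ ≤ K * ‖x - y‖) (hK : 0 ≤ K) (x₀ : X) :
    ∃ x : ℝ → X, x a = x₀ ∧ HasW11Deriv a b x (fun s => G s (x s)) ∧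
      ∀ t ∈ Icc a b, Tendsto (fun k => picardIterate a G x₀ k t) atTop (𝓝 (x t)) := by
  obtain ⟨C, hC⟩ : ∃ C, ∀ t ∈ Icc a b, ‖picardIterate a G x₀ 1 t - x₀‖ ≤ C := by
    have h1 : ContinuousOn (fun t => picardIterate a G x₀ 1 t - x₀) (Icc a b) :=
      (continuousOn_picardIterate hint 1).sub continuousOn_const
    exact isCompact_Icc.exists_bound_of_continuousOn h1
  have hC0 : 0 ≤ C := (norm_nonneg _).trans (hC a (left_mem_Icc.2 hab))
  set d : ℕ → ℝ := fun k => C * ((K * (b - a)) ^ k / k.factorial) with hd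
  have hsum : Summable d := (Real.summable_pow_div_factorial (K * (b - a))).mul_left C
  have hdist : ∀ t ∈ Icc a b, ∀ k,
      dist (picardIterate a G x₀ k t) (picardIterate a G x₀ k.succ t) ≤ d k := by
    intro t ht k
    rw [dist_comm, dist_eq_norm]
    refine (norm_picardIterate_succ_sub_le hint hlip hK hC k t ht).trans ?_
    have : 0 ≤ t - a := sub_nonneg.2 ht.1
    have := ht.2
    simp only [hd]
    gcongr
  have hlim : ∀ t, ∃ l, t ∈ Icc a b →
      Tendsto (fun k => picardIterate a G x₀ k t) atTop (𝓝 l) := by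
    intro t
    by_cases ht : t ∈ Icc a b
    · obtain ⟨l, hl⟩ := cauchySeq_tendsto_of_complete
        (cauchySeq_of_dist_le_of_summable d (hdist t ht) hsum)
      exact ⟨l, fun _ => hl⟩
    · exact ⟨0, fun h => absurd h ht⟩
  choose x hx using hlim
  -- The tail of the series bounds the distance to the limit uniformly in time. This makes the limit
  -- continuous and lets the iterates pass to the limit under the integral.
  set τ : ℕ → ℝ := fun k => ∑' m, d (k + m) with hτ
  have htail : ∀ t ∈ Icc a b, ∀ k, dist (picardIterate a G x₀ k t) (x t) ≤ τ k := fun t ht k =>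
    dist_le_tsum_of_dist_le_of_tendsto d (hdist t ht) hsum (hx t ht) k
  have hτ0 : Tendsto τ atTop (𝓝 0) := by
    have := tendsto_sum_nat_add d
    simpa only [hτ, add_comm] using this
  have hunif : TendstoUniformlyOn (picardIterate a G x₀) x atTop (Icc a b) := by
    rw [Metric.tendstoUniformlyOn_iff]
    intro ε hε
    filter_upwards [hτ0.eventually (gt_mem_nhds hε)] with k hk t ht
    rw [dist_comm]
    exact (htail t ht k).trans_lt hk
  have hxc : ContinuousOn x (Icc a b) :=
    hunif.continuousOn (Eventually.frequently (Eventually.of_forall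
      (continuousOn_picardIterate hint)))
  have hxa : x a = x₀ := by
    refine tendsto_nhds_unique (hx a (left_mem_Icc.2 hab)) ?_
    refine tendsto_const_nhds.congr fun k => ?_
    cases k <;> simp [picardIterate]
  refine ⟨x, hxa, ⟨hint x hxc, fun t ht => ?_⟩, hx⟩
  have ha : a ∈ Icc a b := left_mem_Icc.2 hab
  have hsub : ∀ y : ℝ → X, ContinuousOn y (Icc a b) →
      IntervalIntegrable (fun s => G s (y s)) volume a t := fun y hy =>
    (hint y hy).mono_set (by
      rw [uIcc_of_le hab, uIcc_of_le ht.1]; exact Icc_subset_Icc_right ht.2)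
  have hI : Tendsto (fun k => ∫ s in a..t, G s (picardIterate a G x₀ k s)) atTop
      (𝓝 (∫ s in a..t, G s (x s))) := by
    rw [tendsto_iff_dist_tendsto_zero]
    refine squeeze_zero (fun _ => dist_nonneg) (fun k => ?_)
      (g := fun k => K * τ k * |t - a|) (by simpa using (hτ0.const_mul K).mul_const |t - a|)
    rw [dist_eq_norm, ← intervalIntegral.integral_sub
      (hsub _ (continuousOn_picardIterate hint k)) (hsub _ hxc)]
    refine intervalIntegral.norm_integral_le_of_norm_le_const fun s hs => ?_
    rw [uIoc_of_le ht.1] at hs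
    have hs' : s ∈ Icc a b := ⟨hs.1.le, hs.2.trans ht.2⟩
    refine (hlip s hs' _ _).trans (mul_le_mul_of_nonneg_left ?_ hK)
    rw [← dist_eq_norm]
    exact htail s hs' k
  rw [hxa]
  exact tendsto_nhds_unique ((hx t ht).comp (tendsto_add_atTop_nat 1)) (hI.const_add x₀)

/-- Stability of solutions: an arc whose velocity is bounded by `K ‖z‖ + c` stays within
`‖z(a)‖ + c (b - a)` times the exponential factor. -/
theorem HasW11Deriv.norm_le_exp {z v : ℝ → X} {c : ℝ} (h : HasW11Deriv a b z v)
    (hK : 0 ≤ K) (hc : 0 ≤ c)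
    (hv : ∀ᵐ t ∂volume.restrict (Icc a b), ‖v t‖ ≤ K * ‖z t‖ + c) :
    ∀ t ∈ Icc a b, ‖z t‖ ≤ (‖z a‖ + c * (b - a)) * Real.exp (K * (t - a)) := by
  refine le_mul_exp_of_le_add_integral hK h.continuousOn.norm fun t ht => ?_
  have hsub : IntervalIntegrable (fun s => ‖z s‖) volume a t :=
    (h.continuousOn.norm.mono (Icc_subset_Icc_right ht.2)).intervalIntegrable_of_Icc ht.1
  have hv' : ∀ᵐ s, s ∈ Ioc a t → ‖v s‖ ≤ K * ‖z s‖ + c := by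
    filter_upwards [(ae_restrict_iff' measurableSet_Icc).1 hv] with s hs hst
    exact hs ⟨hst.1.le, hst.2.trans ht.2⟩
  have h1 := intervalIntegral.norm_integral_le_of_norm_le ht.1 hv'
    ((hsub.const_mul K).add intervalIntegrable_const)
  rw [intervalIntegral.integral_add (hsub.const_mul K) intervalIntegrable_const,
    intervalIntegral.integral_const_mul, intervalIntegral.integral_const, smul_eq_mul] at h1
  rw [h.2 t ht]
  have h2 : (t - a) * c ≤ c * (b - a) := by nlinarith [ht.2]
  linarith [norm_add_le (z a) (∫ s in a..t, v s)]

theorem HasW11Deriv.eqOn_zero {z v : ℝ → X} (h : HasW11Deriv a b z v) (hK : 0 ≤ K)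
    (hv : ∀ᵐ t ∂volume.restrict (Icc a b), ‖v t‖ ≤ K * ‖z t‖) (hza : z a = 0) :
    ∀ t ∈ Icc a b, z t = 0 := fun t ht => by
  have := h.norm_le_exp hK le_rfl (by simpa using hv) t ht
  simpa [hza] using this

/-- Time reversal of an arc. -/
theorem HasW11Deriv.reverse {z v : ℝ → X} (h : HasW11Deriv a b z v) (hab : a ≤ b) :
    HasW11Deriv a b (fun t => z (a + b - t)) (fun t => -v (a + b - t)) := by
  refine ⟨?_, fun t ht => ?_⟩
  · have := h.1.comp_sub_left (a + b)
    simp only [add_sub_cancel_left, add_sub_cancel_right] at this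
    exact this.symm.neg
  · have hmem : a + b - t ∈ Icc a b := ⟨by linarith [ht.2], by linarith [ht.1]⟩
    have := h.sub_eq hmem (right_mem_Icc.2 hab)
    rw [intervalIntegral.integral_neg, intervalIntegral.integral_comp_sub_left]
    simp only [add_sub_cancel_left]
    rw [← this]
    abel

end Picard

/-- Every relative neighbourhood of a point of a nondegenerate interval, endpoints included, has
positive measure. This is the device that turns almost-every-time assumptions into every-time ones.
-/
theorem frequently_nhdsWithin_Icc_of_ae {a b : ℝ} (hab : a < b) {Q : ℝ → Prop}
    (hQ : ∀ᵐ t ∂volume.restrict (Icc a b), Q t) {t : ℝ} (ht : t ∈ Icc a b) :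
    ∃ᶠ s in 𝓝[Icc a b] t, Q s := by
  intro hcon
  obtain ⟨U, hU, htU, hUQ⟩ := mem_nhdsWithin.1 hcon
  have hne : (U ∩ Ioo a b).Nonempty := by
    have : t ∈ closure (Ioo a b) := by rwa [closure_Ioo hab.ne]
    exact mem_closure_iff.1 this U hU htU
  have hpos := (hU.inter isOpen_Ioo).measure_pos volume hne
  refine hpos.ne' (measure_mono_null ?_ (ae_iff.1 ((ae_restrict_iff' measurableSet_Icc).1 hQ)))
  rintro s ⟨hsU, hs⟩
  have := hUQ ⟨hsU, Ioo_subset_Icc_self hs⟩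
  simp only [mem_ofPred_eq] at this ⊢
  exact fun h => this (h (Ioo_subset_Icc_self hs))

theorem prod_restrict_le_of_subset {α β : Type*} [MeasurableSpace α] [MeasurableSpace β]
    (ν : Measure α) [SFinite ν] (μ : Measure β) [SFinite μ] {s t : Set α} (hs : MeasurableSet s)
    (hst : s ⊆ t) : (ν.restrict s).prod μ ≤ (ν.restrict t).prod μ := by
  have e : (ν.restrict s).prod μ = ((ν.restrict t).prod μ).restrict (s ×ˢ univ) := by
    rw [← Measure.prod_restrict, Measure.restrict_univ, Measure.restrict_restrict hs,
      inter_eq_left.2 hst]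
  rw [e]
  exact Measure.restrict_le_self

/-! ### Joint measurability in time and parameter -/

section Caratheodory

variable {Ω E : Type*} [MeasurableSpace Ω] {μ : Measure Ω}
  [NormedAddCommGroup E]

/-- A family of arcs, continuous in time and measurable in the parameter, is jointly measurable. -/
theorem aestronglyMeasurable_uncurry_of_continuousOn {a b : ℝ} (hab : a ≤ b) {x : ℝ → Ω → E}
    (hx : ∀ t ∈ Icc a b, AEStronglyMeasurable (x t) μ)
    (hc : ∀ ω, ContinuousOn (fun t => x t ω) (Icc a b)) :
    AEStronglyMeasurable (fun z : ℝ × Ω => x z.1 z.2)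
      ((volume.restrict (Icc a b)).prod μ) := by
  have hpr : StronglyMeasurable (projIcc a b hab) := continuous_projIcc.stronglyMeasurable
  -- Simple functions approximating the identity of the interval reduce time to finitely many
  -- values, where each slice is measurable; continuity in time recovers the arc in the limit.
  set π := hpr.approx with hπ
  have hcomp : ∀ k, AEStronglyMeasurable (fun z : ℝ × Ω => x (π k z.1) z.2)
      ((volume.restrict (Icc a b)).prod μ) := by
    intro k
    have : (fun z : ℝ × Ω => x (π k z.1) z.2) = fun z => ∑ c ∈ (π k).range,
        indicator (Prod.fst ⁻¹' (π k ⁻¹' {c})) (fun z : ℝ × Ω => x c z.2) z := by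
      ext1 z
      rw [Finset.sum_eq_single (π k z.1)]
      · rw [indicator_of_mem (by simp)]
      · intro c _ hc
        exact indicator_of_notMem (by simpa using hc.symm) _
      · intro h
        exact absurd (SimpleFunc.mem_range_self _ _) h
    rw [this]
    refine Finset.aestronglyMeasurable_fun_sum _ fun c _ => ?_
    exact ((hx c c.2).comp_snd).indicator (measurable_fst ((π k).measurableSet_fiber c))
  refine aestronglyMeasurable_of_tendsto_ae atTop hcomp ?_
  have hae : ∀ᵐ z ∂(volume.restrict (Icc a b)).prod μ, z.1 ∈ Icc a b :=
    Measure.quasiMeasurePreserving_fst.ae (ae_restrict_mem measurableSet_Icc)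
  filter_upwards [hae] with z hz
  have h1 := hpr.tendsto_approx z.1
  have h2 : Tendsto (fun k => ((π k z.1 : Icc a b) : ℝ)) atTop (𝓝[Icc a b] z.1) := by
    refine tendsto_nhdsWithin_iff.2 ⟨?_, Eventually.of_forall fun k => (π k z.1).2⟩
    have := (continuous_subtype_val.tendsto _).comp h1
    rwa [projIcc_of_mem hab hz] at this
  exact (hc z.2 z.1 hz).tendsto.comp h2

/-- Parameter dependence of the Picard iterates is measurable. -/
theorem aestronglyMeasurable_picardIterate [SFinite μ] [NormedSpace ℝ E] {a b : ℝ} (hab : a ≤ b)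
    {G : ℝ → E → Ω → E} {φ : Ω → E} (hφ : AEStronglyMeasurable φ μ)
    (hint : ∀ ω, ∀ y : ℝ → E, ContinuousOn y (Icc a b) →
      IntervalIntegrable (fun s => G s (y s) ω) volume a b)
    (hG : ∀ y : ℝ → Ω → E, AEStronglyMeasurable (fun z : ℝ × Ω => y z.1 z.2)
        ((volume.restrict (Icc a b)).prod μ) →
      AEStronglyMeasurable (fun z : ℝ × Ω => G z.1 (y z.1 z.2) z.2)
        ((volume.restrict (Icc a b)).prod μ)) (k : ℕ) :
    ∀ t ∈ Icc a b,
      AEStronglyMeasurable (fun ω => picardIterate a (fun s x => G s x ω) (φ ω) k t) μ := by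
  induction k with
  | zero => exact fun _ _ => hφ
  | succ k ih =>
    intro t ht
    have h1 := hG _ (aestronglyMeasurable_uncurry_of_continuousOn hab ih
      (fun ω => continuousOn_picardIterate (hint ω) k))
    have h2 : AEStronglyMeasurable (fun z : ℝ × Ω => G z.1
        (picardIterate a (fun s x => G s x z.2) (φ z.2) k z.1) z.2)
        ((volume.restrict (Ioc a t)).prod μ) := by
      refine h1.mono_measure (prod_restrict_le_of_subset volume μ measurableSet_Ioc ?_)
      exact fun s hs => ⟨hs.1.le, hs.2.trans ht.2⟩
    have h3 := h2.prod_swap.integral_prod_right'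
    simp only [Prod.fst_swap, Prod.snd_swap] at h3
    refine hφ.add (h3.congr (ae_of_all _ fun ω => ?_))
    simp only [intervalIntegral.integral_of_le ht.1]

end Caratheodory

/-! ### Measurable substitutes for derivatives and brackets -/

section DirectionalLimit

variable {Ω E G : Type*} [NormedAddCommGroup E] [NormedSpace ℝ E] [NormedAddCommGroup G]
  [NormedSpace ℝ G]

/-- The limit of the difference quotients of `F(·,ω)` at `x` in the direction `v`. -/
noncomputable def dirLim (F : E → Ω → G) (x v : E) (ω : Ω) : G :=
  limUnder atTop fun m : ℕ => (m : ℝ) • (F (x + (m : ℝ)⁻¹ • v) ω - F x ω)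

theorem dirLim_eq_fderiv {F : E → Ω → G} {x : E} {ω : Ω}
    (h : DifferentiableAt ℝ (fun y => F y ω) x) (v : E) :
    dirLim F x v ω = fderiv ℝ (fun y => F y ω) x v := by
  refine Tendsto.limUnder_eq (h.hasFDerivAt.lim v ?_)
  simpa using tendsto_natCast_atTop_atTop (R := ℝ)

/-- A measurable function that agrees with the Lie bracket wherever the fields are
differentiable. -/
noncomputable def bracketLim (V W : E → Ω → E) (x : E) (ω : Ω) : E :=
  dirLim W x (V x ω) ω - dirLim V x (W x ω) ω

theorem bracketLim_eq_lieBracket {V W : E → Ω → E} {x : E} {ω : Ω}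
    (hV : DifferentiableAt ℝ (fun y => V y ω) x) (hW : DifferentiableAt ℝ (fun y => W y ω) x) :
    bracketLim V W x ω = VectorField.lieBracket ℝ (fun y => V y ω) (fun y => W y ω) x := by
  rw [bracketLim, dirLim_eq_fderiv hV, dirLim_eq_fderiv hW, VectorField.lieBracket]

/-- An iterated bracket differentiates the inner one, whose substitute is known to be correct only
near the arc; agreement of germs is enough. -/
theorem dirLim_congr {F F' : E → Ω → G} {x : E} {ω : Ω}
    (h : (fun y => F y ω) =ᶠ[𝓝 x] fun y => F' y ω)
    (hF' : DifferentiableAt ℝ (fun y => F' y ω) x) (v : E) :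
    dirLim F x v ω = fderiv ℝ (fun y => F' y ω) x v := by
  rw [dirLim_eq_fderiv (hF'.congr_of_eventuallyEq h), h.fderiv_eq]

variable [MeasurableSpace Ω] [MeasurableSpace E] [BorelSpace E] [SecondCountableTopology E]
  [MeasurableSpace G] [BorelSpace G] [SecondCountableTopology G] [CompleteSpace G]

/-- A sequential `limUnder` of measurable functions is measurable even where the sequence diverges,
so no differentiability is required. -/
theorem measurable_dirLim {F : E → Ω → G} (hF : Measurable fun z : E × Ω => F z.1 z.2) :
    Measurable fun z : E × E × Ω => dirLim F z.1 z.2.1 z.2.2 := by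
  have : StronglyMeasurable fun z : E × E × Ω => dirLim F z.1 z.2.1 z.2.2 := by
    refine StronglyMeasurable.limUnder fun m => Measurable.stronglyMeasurable ?_
    have h1 : Measurable fun z : E × E × Ω => F (z.1 + (m : ℝ)⁻¹ • z.2.1) z.2.2 :=
      hF.comp (by fun_prop : Measurable fun z : E × E × Ω => (z.1 + (m : ℝ)⁻¹ • z.2.1, z.2.2))
    have h2 : Measurable fun z : E × E × Ω => F z.1 z.2.2 :=
      hF.comp (by fun_prop : Measurable fun z : E × E × Ω => (z.1, z.2.2))
    exact (h1.sub h2).const_smul (m : ℝ)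
  exact this.measurable

theorem aemeasurable_dirLim {F : E → Ω → G} (hF : Measurable fun z : E × Ω => F z.1 z.2)
    {α : Type*} [MeasurableSpace α] {ν : Measure α} {y v : α → E} {ω : α → Ω}
    (hy : AEMeasurable y ν) (hv : AEMeasurable v ν) (hω : AEMeasurable ω ν) :
    AEMeasurable (fun i => dirLim F (y i) (v i) (ω i)) ν :=
  (measurable_dirLim hF).comp_aemeasurable
    (g := fun z : E × E × Ω => dirLim F z.1 z.2.1 z.2.2) (f := fun i => (y i, v i, ω i))
    (hy.prodMk (hv.prodMk hω))

theorem measurable_bracketLim [CompleteSpace E] {V W : E → Ω → E}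
    (hV : Measurable fun z : E × Ω => V z.1 z.2) (hW : Measurable fun z : E × Ω => W z.1 z.2) :
    Measurable fun z : E × Ω => bracketLim V W z.1 z.2 := by
  have h1 : Measurable fun z : E × Ω => dirLim W z.1 (V z.1 z.2) z.2 :=
    (measurable_dirLim hW).comp (g := fun z : E × E × Ω => dirLim W z.1 z.2.1 z.2.2)
      (f := fun z : E × Ω => (z.1, V z.1 z.2, z.2))
      (measurable_fst.prodMk (hV.prodMk measurable_snd))
  have h2 : Measurable fun z : E × Ω => dirLim V z.1 (W z.1 z.2) z.2 :=
    (measurable_dirLim hV).comp (g := fun z : E × E × Ω => dirLim V z.1 z.2.1 z.2.2)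
      (f := fun z : E × Ω => (z.1, W z.1 z.2, z.2))
      (measurable_fst.prodMk (hW.prodMk measurable_snd))
  unfold bracketLim
  exact h1.sub h2

end DirectionalLimit

/-- Scalar tests suffice in finite dimension. Pairing with a fixed `v` turns transposed Jacobians
and gradients into derivatives in the direction `v`, to which `dirLim` applies. -/
theorem aemeasurable_of_inner {α : Type*} [MeasurableSpace α] {ν : Measure α} {n : ℕ}
    {F : α → StateSpace n} (h : ∀ v, AEMeasurable (fun s => inner ℝ v (F s)) ν) :
    AEMeasurable F ν := by
  have : F = fun s => ∑ i, inner ℝ (EuclideanSpace.basisFun (Fin n) ℝ i) (F s) •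
      EuclideanSpace.basisFun (Fin n) ℝ i := by
    ext1 s
    exact ((EuclideanSpace.basisFun (Fin n) ℝ).sum_repr' (F s)).symm
  rw [this]
  exact Finset.aemeasurable_fun_sum _ fun i _ => (h _).smul_const _

theorem intervalIntegrable_of_norm_le {E : Type*} [NormedAddCommGroup E] {a b C : ℝ}
    (hab : a ≤ b) {f : ℝ → E} (hf : AEStronglyMeasurable f (volume.restrict (Icc a b)))
    (hC : ∀ t ∈ Icc a b, ‖f t‖ ≤ C) : IntervalIntegrable f volume a b := by
  rw [intervalIntegrable_iff_integrableOn_Ioc_of_le hab, ← integrableOn_Icc_iff_integrableOn_Ioc]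
  refine Integrable.of_bound hf C ?_
  filter_upwards [ae_restrict_mem measurableSet_Icc] with t ht using hC t ht

/-! ### Uniform constants and strict controls -/

namespace AffineProblem

variable {n : ℕ} {Ω : Type*} {P : AffineProblem n Ω}

/-- Growth and Lipschitz constants that serve for `f₀`, `f₁` and the dynamics at once. -/
structure UniformBounds (P : AffineProblem n Ω) (c K D : ℝ) : Prop where
  c_nonneg : 0 ≤ c
  K_nonneg : 0 ≤ K
  D_nonneg : 0 ≤ D
  control_le : ∀ u ∈ Icc P.umin P.umax, |u| ≤ D
  f₀_le : ∀ x ω, ‖P.f₀ x ω‖ ≤ c * (1 + ‖x‖)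
  f₁_le : ∀ x ω, ‖P.f₁ x ω‖ ≤ c * (1 + ‖x‖)
  f₀_lip : ∀ x y ω, ‖P.f₀ x ω - P.f₀ y ω‖ ≤ K * ‖x - y‖
  f₁_lip : ∀ x y ω, ‖P.f₁ x ω - P.f₁ y ω‖ ≤ K * ‖x - y‖
  dyn_le : ∀ u ∈ Icc P.umin P.umax, ∀ x ω, ‖P.dyn x u ω‖ ≤ c * (1 + ‖x‖)
  dyn_lip : ∀ u ∈ Icc P.umin P.umax, ∀ x y ω, ‖P.dyn x u ω - P.dyn y u ω‖ ≤ K * ‖x - y‖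

theorem H0.exists_uniformBounds [MeasurableSpace Ω] (h0 : P.H0) :
    ∃ c K D, P.UniformBounds c K D := by
  obtain ⟨c₀, hc₀, h₀⟩ := h0.growth_f₀
  obtain ⟨c₁, hc₁, h₁⟩ := h0.growth_f₁
  obtain ⟨k₀, hk₀, l₀⟩ := h0.lip_f₀
  obtain ⟨k₁, hk₁, l₁⟩ := h0.lip_f₁
  set D := max |P.umin| |P.umax| with hD
  have hD0 : 0 ≤ D := le_max_of_le_left (abs_nonneg _)
  have hu : ∀ u ∈ Icc P.umin P.umax, |u| ≤ D := fun u hu => abs_le_max_abs_abs hu.1 hu.2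
  -- The factor `1 + D` instead of `D` lets the same constant bound `f₁` alone even when `D < 1`.
  refine ⟨c₀ + (1 + D) * c₁, k₀ + (1 + D) * k₁, D, by positivity, by positivity, hD0, hu,
    fun x ω => (h₀ x ω).trans ?_, fun x ω => (h₁ x ω).trans ?_, fun x y ω => (l₀ x y ω).trans ?_,
    fun x y ω => (l₁ x y ω).trans ?_, fun u huU x ω => ?_, fun u huU x y ω => ?_⟩
  · gcongr; nlinarith
  · gcongr; nlinarith
  · gcongr; nlinarith
  · gcongr; nlinarith
  · have h2 : ‖P.dyn x u ω‖ ≤ ‖P.f₀ x ω‖ + |u| * ‖P.f₁ x ω‖ := by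
      rw [← Real.norm_eq_abs, ← norm_smul]; exact norm_add_le _ _
    have h3 : |u| * ‖P.f₁ x ω‖ ≤ D * (c₁ * (1 + ‖x‖)) :=
      mul_le_mul (hu u huU) (h₁ x ω) (norm_nonneg _) hD0
    have h4 : 0 ≤ c₁ * (1 + ‖x‖) := by positivity
    nlinarith [h₀ x ω]
  · have e : P.dyn x u ω - P.dyn y u ω =
        (P.f₀ x ω - P.f₀ y ω) + u • (P.f₁ x ω - P.f₁ y ω) := by
      simp only [dyn, smul_sub]; abel
    have h2 : ‖P.dyn x u ω - P.dyn y u ω‖ ≤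
        ‖P.f₀ x ω - P.f₀ y ω‖ + |u| * ‖P.f₁ x ω - P.f₁ y ω‖ := by
      rw [e, ← Real.norm_eq_abs, ← norm_smul]; exact norm_add_le _ _
    have h3 : |u| * ‖P.f₁ x ω - P.f₁ y ω‖ ≤ D * (k₁ * ‖x - y‖) :=
      mul_le_mul (hu u huU) (l₁ x y ω) (norm_nonneg _) hD0
    have h4 : 0 ≤ k₁ * ‖x - y‖ := by positivity
    nlinarith [l₀ x y ω]

/-- A control that is Borel measurable and takes its values in `[umin, umax]` everywhere. -/
def IsStrictControl (P : AffineProblem n Ω) (w : ℝ → ℝ) : Prop :=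
  Measurable w ∧ ∀ t, w t ∈ Icc P.umin P.umax

theorem IsStrictControl.isAdmissibleControl {w : ℝ → ℝ} (h : P.IsStrictControl w) :
    P.IsAdmissibleControl w :=
  ⟨h.1.aestronglyMeasurable, ae_of_all _ h.2⟩

/-- Project a measurable version of the control onto the interval; this changes it only on a null
set. -/
theorem IsAdmissibleControl.exists_isStrictControl {u : ℝ → ℝ} (h : P.IsAdmissibleControl u) :
    ∃ w, P.IsStrictControl w ∧ u =ᵐ[volume.restrict (Icc P.t₀ P.T)] w := by
  refine ⟨fun t => projIcc P.umin P.umax P.control_lt.le (h.1.mk u t), ⟨?_, fun t => ?_⟩, ?_⟩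
  · exact measurable_subtype_coe.comp
      (continuous_projIcc.measurable.comp h.1.stronglyMeasurable_mk.measurable)
  · exact (projIcc P.umin P.umax P.control_lt.le (h.1.mk u t)).2
  · filter_upwards [h.1.ae_eq_mk, h.2] with t ht htU
    rw [← ht, projIcc_of_mem _ htU]

theorem IsAdmissible.congr_control {u w : ℝ → ℝ} {x : ℝ → Ω → StateSpace n}
    (h : P.IsAdmissible u x) (hw : P.IsStrictControl w)
    (huw : u =ᵐ[volume.restrict (Icc P.t₀ P.T)] w) : P.IsAdmissible w x := by
  refine ⟨hw.isAdmissibleControl, fun ω => ⟨(h.2 ω).1, (h.2 ω).2.congr_ae P.time_lt.le ?_⟩⟩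
  filter_upwards [huw] with t ht
  rw [ht]

theorem IsAdmissible.continuousOn {u : ℝ → ℝ} {x : ℝ → Ω → StateSpace n}
    (h : P.IsAdmissible u x) (ω : Ω) : ContinuousOn (fun t => x t ω) (Icc P.t₀ P.T) :=
  (h.2 ω).2.continuousOn

/-! ### Existence, uniqueness and measurability of state arcs -/

section Measurability

variable [MeasurableSpace Ω]

theorem H0.measurable_f₀ (h0 : P.H0) :
    Measurable fun z : StateSpace n × Ω => P.f₀ z.1 z.2 := by
  refine measurable_uncurry_of_continuous_of_measurable (u := P.f₀) (fun ω => ?_) h0.meas_f₀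
  obtain ⟨k, hk, h⟩ := h0.lip_f₀
  refine (LipschitzWith.of_dist_le_mul (K := k.toNNReal) fun x y => ?_).continuous
  rw [dist_eq_norm, dist_eq_norm, Real.coe_toNNReal _ hk.le]
  exact h x y ω

theorem H0.measurable_f₁ (h0 : P.H0) :
    Measurable fun z : StateSpace n × Ω => P.f₁ z.1 z.2 := by
  refine measurable_uncurry_of_continuous_of_measurable (u := P.f₁) (fun ω => ?_) h0.meas_f₁
  obtain ⟨k, hk, h⟩ := h0.lip_f₁
  refine (LipschitzWith.of_dist_le_mul (K := k.toNNReal) fun x y => ?_).continuous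
  rw [dist_eq_norm, dist_eq_norm, Real.coe_toNNReal _ hk.le]
  exact h x y ω

theorem H0.aemeasurable_dyn (h0 : P.H0) {α : Type*} [MeasurableSpace α] {ν : Measure α}
    {y : α → StateSpace n} {s : α → ℝ} {ω : α → Ω} (hy : AEMeasurable y ν)
    (hs : AEMeasurable s ν) (hω : AEMeasurable ω ν) :
    AEMeasurable (fun i => P.dyn (y i) (s i) (ω i)) ν :=
  (h0.measurable_f₀.comp_aemeasurable (hy.prodMk hω)).add
    (hs.smul (h0.measurable_f₁.comp_aemeasurable (hy.prodMk hω)))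

theorem H0.intervalIntegrable_dyn (h0 : P.H0) {w : ℝ → ℝ} (hw : P.IsStrictControl w) (ω : Ω)
    {y : ℝ → StateSpace n} (hy : ContinuousOn y (Icc P.t₀ P.T)) :
    IntervalIntegrable (fun s => P.dyn (y s) (w s) ω) volume P.t₀ P.T := by
  obtain ⟨c, K, D, hb⟩ := h0.exists_uniformBounds
  obtain ⟨M, hM⟩ := isCompact_Icc.exists_bound_of_continuousOn hy
  refine intervalIntegrable_of_norm_le P.time_lt.le (C := c * (1 + M)) ?_ fun t ht => ?_
  · exact (h0.aemeasurable_dyn (hy.aemeasurable measurableSet_Icc) hw.1.aemeasurable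
      aemeasurable_const).aestronglyMeasurable
  · refine (hb.dyn_le _ (hw.2 t) _ _).trans ?_
    have := hM t ht
    have := hb.c_nonneg
    gcongr

theorem H0.eqOn_of_isAdmissible (h0 : P.H0) {w : ℝ → ℝ} (hw : P.IsStrictControl w)
    {ω : Ω} {y z : ℝ → StateSpace n}
    (hy : HasW11Deriv P.t₀ P.T y fun t => P.dyn (y t) (w t) ω)
    (hz : HasW11Deriv P.t₀ P.T z fun t => P.dyn (z t) (w t) ω) (h : y P.t₀ = z P.t₀) :
    ∀ t ∈ Icc P.t₀ P.T, y t = z t := by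
  obtain ⟨c, K, D, hb⟩ := h0.exists_uniformBounds
  intro t ht
  refine sub_eq_zero.1 ((hy.sub hz).eqOn_zero hb.K_nonneg (ae_of_all _ fun s => ?_)
    (sub_eq_zero.2 h) t ht)
  exact hb.dyn_lip _ (hw.2 s) _ _ _

theorem H0.exists_arc (h0 : P.H0) {w : ℝ → ℝ} (hw : P.IsStrictControl w) (ω : Ω) :
    ∃ y : ℝ → StateSpace n, y P.t₀ = P.φ ω ∧
      HasW11Deriv P.t₀ P.T y (fun t => P.dyn (y t) (w t) ω) ∧
      ∀ t ∈ Icc P.t₀ P.T, Tendsto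
        (fun k => picardIterate P.t₀ (fun s x => P.dyn x (w s) ω) (P.φ ω) k t) atTop
        (𝓝 (y t)) := by
  obtain ⟨c, K, D, hb⟩ := h0.exists_uniformBounds
  exact exists_hasW11Deriv_tendsto_picardIterate P.time_lt.le
    (fun y hy => h0.intervalIntegrable_dyn hw ω hy)
    (fun s _ x y => hb.dyn_lip _ (hw.2 s) x y ω) hb.K_nonneg (P.φ ω)

theorem H0.exists_isAdmissible (h0 : P.H0) {w : ℝ → ℝ} (hw : P.IsStrictControl w) :
    ∃ y, P.IsAdmissible w y := by
  choose y hy using h0.exists_arc hw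
  exact ⟨fun t ω => y ω t, hw.isAdmissibleControl, fun ω => ⟨(hy ω).1, (hy ω).2.1⟩⟩

/-- Admissibility says nothing about measurability in the parameter. Uniqueness forces each arc to
be the limit of its Picard iterates, and these are measurable. -/
theorem H0.aestronglyMeasurable_arc (h0 : P.H0) {μ : Measure Ω} [SFinite μ]
    (hφ : AEStronglyMeasurable P.φ μ) {w : ℝ → ℝ} (hw : P.IsStrictControl w)
    {x : ℝ → Ω → StateSpace n} (hx : P.IsAdmissible w x) :
    ∀ t ∈ Icc P.t₀ P.T, AEStronglyMeasurable (x t) μ := by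
  intro t ht
  refine aestronglyMeasurable_of_tendsto_ae atTop (fun k =>
    aestronglyMeasurable_picardIterate (G := fun s y ω => P.dyn y (w s) ω) P.time_lt.le hφ
    (fun ω y hy => h0.intervalIntegrable_dyn hw ω hy) (fun y hy => ?_) k t ht)
    (ae_of_all _ fun ω => ?_)
  · exact (h0.aemeasurable_dyn hy.aemeasurable (hw.1.comp measurable_fst).aemeasurable
      measurable_snd.aemeasurable).aestronglyMeasurable
  · obtain ⟨y, hy0, hy, hlim⟩ := h0.exists_arc hw ω
    have := h0.eqOn_of_isAdmissible hw (hx.2 ω).2 hy ((hx.2 ω).1.trans hy0.symm) t ht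
    rw [this]
    exact hlim t ht

theorem H0.aestronglyMeasurable_uncurry_arc (h0 : P.H0) {μ : Measure Ω} [SFinite μ]
    (hφ : AEStronglyMeasurable P.φ μ) {w : ℝ → ℝ} (hw : P.IsStrictControl w)
    {x : ℝ → Ω → StateSpace n} (hx : P.IsAdmissible w x) :
    AEStronglyMeasurable (fun z : ℝ × Ω => x z.1 z.2)
      ((volume.restrict (Icc P.t₀ P.T)).prod μ) :=
  aestronglyMeasurable_uncurry_of_continuousOn P.time_lt.le
    (h0.aestronglyMeasurable_arc hφ hw hx) hx.continuousOn

end Measurability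

/-! ### Growth of the arcs and stability in the control -/

section Estimates

variable {c K D : ℝ}

/-- The constant is independent of the control and of the parameter, and growth is linear in the
initial state; all later integrability rests on this. -/
theorem UniformBounds.exists_arc_le (hb : P.UniformBounds c K D) :
    ∃ M, 0 ≤ M ∧ ∀ w x, P.IsStrictControl w → P.IsAdmissible w x →
      ∀ ω, ∀ t ∈ Icc P.t₀ P.T, 1 + ‖x t ω‖ ≤ M * (1 + ‖P.φ ω‖) := by
  have hτ : 0 ≤ P.T - P.t₀ := sub_nonneg.2 P.time_lt.le
  have hc := hb.c_nonneg
  refine ⟨1 + (1 + c * (P.T - P.t₀)) * Real.exp (c * (P.T - P.t₀)), by positivity,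
    fun w x hw hx ω t ht => ?_⟩
  have h1 := (hx.2 ω).2.norm_le_exp hc hc (ae_of_all _ fun s =>
    (hb.dyn_le _ (hw.2 s) (x s ω) ω).trans (by linarith)) t ht
  rw [(hx.2 ω).1] at h1
  have h2 : Real.exp (c * (t - P.t₀)) ≤ Real.exp (c * (P.T - P.t₀)) := by
    have := ht.2
    gcongr
  have h3 : (‖P.φ ω‖ + c * (P.T - P.t₀)) * Real.exp (c * (t - P.t₀)) ≤
      (1 + ‖P.φ ω‖) * (1 + c * (P.T - P.t₀)) * Real.exp (c * (P.T - P.t₀)) := by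
    refine mul_le_mul ?_ h2 (Real.exp_pos _).le (by positivity)
    have : 0 ≤ ‖P.φ ω‖ * (c * (P.T - P.t₀)) := by positivity
    nlinarith [norm_nonneg (P.φ ω)]
  nlinarith [norm_nonneg (P.φ ω)]

/-- Lipschitz dependence of the arcs on the control, in the uniform norm. -/
theorem UniformBounds.exists_stability (hb : P.UniformBounds c K D) :
    ∃ C, 0 ≤ C ∧ ∀ w w' x y ε, 0 ≤ ε → P.IsStrictControl w → P.IsStrictControl w' →
      (∀ t, |w' t - w t| ≤ ε) → P.IsAdmissible w x → P.IsAdmissible w' y →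
      ∀ ω, ∀ t ∈ Icc P.t₀ P.T, ‖y t ω - x t ω‖ ≤ C * ε * (1 + ‖P.φ ω‖) ∧
        ‖P.dyn (y t ω) (w' t) ω - P.dyn (x t ω) (w t) ω‖ ≤ C * ε * (1 + ‖P.φ ω‖) := by
  obtain ⟨M, hM, hx_le⟩ := hb.exists_arc_le
  have hτ : 0 ≤ P.T - P.t₀ := sub_nonneg.2 P.time_lt.le
  have hc := hb.c_nonneg
  have hK := hb.K_nonneg
  set A := c * M * (P.T - P.t₀) * Real.exp (K * (P.T - P.t₀)) with hA
  have hA0 : 0 ≤ A := by positivity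
  refine ⟨A + (K * A + c * M), by positivity, fun w w' x y ε hε hw hw' hww hx hy ω => ?_⟩
  set r := 1 + ‖P.φ ω‖ with hr
  have hr0 : 0 ≤ r := by positivity
  have hvel : ∀ t ∈ Icc P.t₀ P.T, ‖P.dyn (y t ω) (w' t) ω - P.dyn (x t ω) (w t) ω‖ ≤
      K * ‖y t ω - x t ω‖ + c * M * ε * r := by
    intro t ht
    -- First the state changes at fixed control, then the control at fixed state: a Lipschitz term
    -- for Grönwall plus a source of size `ε`.
    have e : P.dyn (y t ω) (w' t) ω - P.dyn (x t ω) (w t) ω =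
        (P.dyn (y t ω) (w' t) ω - P.dyn (x t ω) (w' t) ω) + (w' t - w t) • P.f₁ (x t ω) ω := by
      simp only [dyn, sub_smul]; abel
    rw [e]
    refine (norm_add_le _ _).trans (add_le_add (hb.dyn_lip _ (hw'.2 t) _ _ _) ?_)
    rw [norm_smul, Real.norm_eq_abs]
    have h1 : ‖P.f₁ (x t ω) ω‖ ≤ c * (M * r) :=
      (hb.f₁_le _ _).trans (mul_le_mul_of_nonneg_left (hx_le w x hw hx ω t ht) hc)
    calc |w' t - w t| * ‖P.f₁ (x t ω) ω‖ ≤ ε * (c * (M * r)) :=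
          mul_le_mul (hww t) h1 (norm_nonneg _) hε
      _ = c * M * ε * r := by ring
  have hz : ∀ t ∈ Icc P.t₀ P.T, ‖y t ω - x t ω‖ ≤ A * ε * r := by
    intro t ht
    have h1 := ((hy.2 ω).2.sub (hx.2 ω).2).norm_le_exp hK (c := c * M * ε * r) (by positivity)
      (by filter_upwards [ae_restrict_mem measurableSet_Icc] with s hs using hvel s hs) t ht
    simp only [(hx.2 ω).1, (hy.2 ω).1, sub_self, norm_zero, zero_add] at h1
    have h2 : Real.exp (K * (t - P.t₀)) ≤ Real.exp (K * (P.T - P.t₀)) := by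
      have := ht.2
      gcongr
    calc ‖y t ω - x t ω‖ ≤ _ := h1
      _ ≤ c * M * ε * r * (P.T - P.t₀) * Real.exp (K * (P.T - P.t₀)) := by gcongr
      _ = A * ε * r := by rw [hA]; ring
  intro t ht
  have hp1 : 0 ≤ (K * A + c * M) * ε * r := by positivity
  have hp2 : 0 ≤ A * ε * r := by positivity
  have h1 := hz t ht
  have h2 := hvel t ht
  have h3 : K * ‖y t ω - x t ω‖ ≤ K * (A * ε * r) := mul_le_mul_of_nonneg_left h1 hK
  exact ⟨by linarith, by linarith⟩

end Estimates

end AffineProblem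

/-! ### From almost every time to every time along an arc -/

section Tube

variable {E F : Type*} [NormedAddCommGroup E] [NormedSpace ℝ E] [NormedAddCommGroup F]
  [NormedSpace ℝ F] {a b δ : ℝ} {z : ℝ → E} {f : E → F}

/-- A good time `s` close enough to `t` has `z t` inside the open ball of radius `δ` about `z s`,
where `f` is smooth. -/
theorem contDiffAt_of_ae_contDiffOn_ball {k : WithTop ℕ∞} (hab : a < b)
    (hz : ContinuousOn z (Icc a b)) (hδ : 0 < δ)
    (hf : ∀ᵐ t ∂volume.restrict (Icc a b), ContDiffOn ℝ k f (Metric.ball (z t) δ)) {t : ℝ}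
    (ht : t ∈ Icc a b) : ContDiffAt ℝ k f (z t) := by
  have h1 : ∀ᶠ s in 𝓝[Icc a b] t, dist (z s) (z t) < δ :=
    (hz t ht).eventually (Metric.ball_mem_nhds _ hδ)
  obtain ⟨s, hs, hst⟩ := ((frequently_nhdsWithin_Icc_of_ae hab hf ht).and_eventually h1).exists
  refine hs.contDiffAt (Metric.isOpen_ball.mem_nhds ?_)
  rwa [Metric.mem_ball, dist_comm]

/-- The second derivative is continuous at `z t`, so a violation of the bound would persist at
nearby times, among them a good one. -/
theorem norm_fderiv_fderiv_le_of_ae {C : ℝ} (hab : a < b) (hz : ContinuousOn z (Icc a b))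
    (hf : ∀ t ∈ Icc a b, ContDiffAt ℝ 2 f (z t))
    (hC : ∀ᵐ t ∂volume.restrict (Icc a b), ‖fderiv ℝ (fderiv ℝ f) (z t)‖ < C) :
    ∀ t ∈ Icc a b, ‖fderiv ℝ (fderiv ℝ f) (z t)‖ ≤ C := by
  intro t ht
  by_contra! hcon
  have h2 : ContDiffAt ℝ 1 (fderiv ℝ f) (z t) := (hf t ht).fderiv_right (by norm_num)
  have h3 : ContDiffAt ℝ 0 (fderiv ℝ (fderiv ℝ f)) (z t) := h2.fderiv_right (by norm_num)
  have h4 : ContinuousAt (fun y => ‖fderiv ℝ (fderiv ℝ f) y‖) (z t) :=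
    (continuous_norm (E := E →L[ℝ] E →L[ℝ] F)).continuousAt.comp h3.continuousAt
  obtain ⟨s, hs, hs'⟩ := ((frequently_nhdsWithin_Icc_of_ae hab hC ht).and_eventually
    ((hz t ht).eventually (h4.eventually (lt_mem_nhds hcon)))).exists
  exact lt_asymm hs hs'

end Tube

/-! ### Regular processes and their Jacobians -/

namespace AffineProblem

variable {n : ℕ} {Ω : Type*} {P : AffineProblem n Ω}

/-- A process with a strict control along which `f₀` and `f₁` are twice continuously
differentiable. -/
structure IsRegular (P : AffineProblem n Ω) (w : ℝ → ℝ) (x : ℝ → Ω → StateSpace n) :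
    Prop where
  control : P.IsStrictControl w
  adm : P.IsAdmissible w x
  smooth₀ : ∀ ω, ∀ t ∈ Icc P.t₀ P.T, ContDiffAt ℝ 2 (fun y => P.f₀ y ω) (x t ω)
  smooth₁ : ∀ ω, ∀ t ∈ Icc P.t₀ P.T, ContDiffAt ℝ 2 (fun y => P.f₁ y ω) (x t ω)

section

variable {w : ℝ → ℝ} {x : ℝ → Ω → StateSpace n}

theorem IsRegular.diff₀ (h : P.IsRegular w x) (ω : Ω) {t : ℝ} (ht : t ∈ Icc P.t₀ P.T) :
    DifferentiableAt ℝ (fun y => P.f₀ y ω) (x t ω) :=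
  (h.smooth₀ ω t ht).differentiableAt two_ne_zero

theorem IsRegular.diff₁ (h : P.IsRegular w x) (ω : Ω) {t : ℝ} (ht : t ∈ Icc P.t₀ P.T) :
    DifferentiableAt ℝ (fun y => P.f₁ y ω) (x t ω) :=
  (h.smooth₁ ω t ht).differentiableAt two_ne_zero

theorem hasFDerivAt_dyn {ω : Ω} {y : StateSpace n}
    (h₀ : DifferentiableAt ℝ (fun y => P.f₀ y ω) y)
    (h₁ : DifferentiableAt ℝ (fun y => P.f₁ y ω) y) (u : ℝ) :
    HasFDerivAt (fun y => P.dyn y u ω)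
      (fderiv ℝ (fun y => P.f₀ y ω) y + u • fderiv ℝ (fun y => P.f₁ y ω) y) y :=
  h₀.hasFDerivAt.add (h₁.hasFDerivAt.const_smul u)

theorem dynJac_eq {ω : Ω} {y : StateSpace n}
    (h₀ : DifferentiableAt ℝ (fun y => P.f₀ y ω) y)
    (h₁ : DifferentiableAt ℝ (fun y => P.f₁ y ω) y) (u : ℝ) :
    P.dynJac y u ω = fderiv ℝ (fun y => P.f₀ y ω) y + u • fderiv ℝ (fun y => P.f₁ y ω) y :=
  (hasFDerivAt_dyn h₀ h₁ u).fderiv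

/-- No differentiability is needed: where it fails, `fderiv` is zero. -/
theorem UniformBounds.norm_dynJac_le {c K D : ℝ} (hb : P.UniformBounds c K D) {u : ℝ}
    (hu : u ∈ Icc P.umin P.umax) (y : StateSpace n) (ω : Ω) : ‖P.dynJac y u ω‖ ≤ K :=
  norm_fderiv_le_of_lip' ℝ hb.K_nonneg (Eventually.of_forall fun z => hb.dyn_lip u hu z y ω)

theorem UniformBounds.norm_adjoint_dynJac_le {c K D : ℝ} (hb : P.UniformBounds c K D) {u : ℝ}
    (hu : u ∈ Icc P.umin P.umax) (y : StateSpace n) (ω : Ω) (q : StateSpace n) :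
    ‖ContinuousLinearMap.adjoint (P.dynJac y u ω) q‖ ≤ K * ‖q‖ := by
  refine (ContinuousLinearMap.le_opNorm _ q).trans (mul_le_mul_of_nonneg_right ?_ (norm_nonneg q))
  rw [LinearIsometryEquiv.norm_map]
  exact hb.norm_dynJac_le hu y ω

theorem UniformBounds.norm_fderiv_f₀_le {c K D : ℝ} (hb : P.UniformBounds c K D)
    (y : StateSpace n) (ω : Ω) : ‖fderiv ℝ (fun y => P.f₀ y ω) y‖ ≤ K :=
  norm_fderiv_le_of_lip' ℝ hb.K_nonneg (Eventually.of_forall fun z => hb.f₀_lip z y ω)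

theorem UniformBounds.norm_fderiv_f₁_le {c K D : ℝ} (hb : P.UniformBounds c K D)
    (y : StateSpace n) (ω : Ω) : ‖fderiv ℝ (fun y => P.f₁ y ω) y‖ ≤ K :=
  norm_fderiv_le_of_lip' ℝ hb.K_nonneg (Eventually.of_forall fun z => hb.f₁_lip z y ω)

end

theorem H0.aemeasurable_adjoint_dynJac [MeasurableSpace Ω] (h0 : P.H0) {α : Type*}
    [MeasurableSpace α] {ν : Measure α} {y q : α → StateSpace n} {s : α → ℝ} {ω : α → Ω}
    (hy : AEMeasurable y ν) (hq : AEMeasurable q ν) (hs : AEMeasurable s ν)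
    (hω : AEMeasurable ω ν)
    (hd₀ : ∀ᵐ i ∂ν, DifferentiableAt ℝ (fun z => P.f₀ z (ω i)) (y i))
    (hd₁ : ∀ᵐ i ∂ν, DifferentiableAt ℝ (fun z => P.f₁ z (ω i)) (y i)) :
    AEMeasurable (fun i => ContinuousLinearMap.adjoint (P.dynJac (y i) (s i) (ω i)) (q i)) ν := by
  refine aemeasurable_of_inner fun v => ?_
  have h₀ : AEMeasurable (fun i => dirLim P.f₀ (y i) v (ω i)) ν :=
    aemeasurable_dirLim h0.measurable_f₀ hy aemeasurable_const hω
  have h₁ : AEMeasurable (fun i => dirLim P.f₁ (y i) v (ω i)) ν :=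
    aemeasurable_dirLim h0.measurable_f₁ hy aemeasurable_const hω
  refine ((h₀.add (hs.smul h₁)).inner hq (𝕜 := ℝ)).congr ?_
  filter_upwards [hd₀, hd₁] with i hi₀ hi₁
  rw [ContinuousLinearMap.adjoint_inner_right, dynJac_eq hi₀ hi₁]
  simp [dirLim_eq_fderiv hi₀, dirLim_eq_fderiv hi₁]

/-! ### Construction of bounded pathwise adjoint arcs -/

section Costate

variable [MetricSpace Ω] [MeasurableSpace Ω] {μ : Measure Ω} {w : ℝ → ℝ}
  {x : ℝ → Ω → StateSpace n} {δ : ℝ}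

theorem H1.isRegular (h1 : P.H1 μ x δ) (hδ : 0 < δ) (hw : P.IsStrictControl w)
    (hx : P.IsAdmissible w x) : P.IsRegular w x :=
  ⟨hw, hx,
    fun ω _ ht => contDiffAt_of_ae_contDiffOn_ball P.time_lt (hx.continuousOn ω) hδ (h1.c2_f₀ ω) ht,
    fun ω _ ht => contDiffAt_of_ae_contDiffOn_ball P.time_lt (hx.continuousOn ω) hδ (h1.c2_f₁ ω) ht⟩

theorem H1.exists_snd_bound (h1 : P.H1 μ x δ) (hr : P.IsRegular w x) :
    ∃ C, 0 ≤ C ∧ ∀ ω ∈ μ.support, ∀ t ∈ Icc P.t₀ P.T,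
      ‖fderiv ℝ (fderiv ℝ fun y => P.f₀ y ω) (x t ω)‖ ≤ C ∧
      ‖fderiv ℝ (fderiv ℝ fun y => P.f₁ y ω) (x t ω)‖ ≤ C := by
  obtain ⟨_, C₀, _, hC₀, h₀⟩ := h1.bound_f₀
  obtain ⟨_, C₁, _, hC₁, h₁⟩ := h1.bound_f₁
  refine ⟨max C₀ C₁, le_max_of_le_left hC₀.le, fun ω hω t ht => ⟨?_, ?_⟩⟩
  · exact (norm_fderiv_fderiv_le_of_ae P.time_lt (hr.adm.continuousOn ω) (hr.smooth₀ ω)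
      ((h₀ ω hω).mono fun _ h => h.2) t ht).trans (le_max_left _ _)
  · exact (norm_fderiv_fderiv_le_of_ae P.time_lt (hr.adm.continuousOn ω) (hr.smooth₁ ω)
      ((h₁ ω hω).mono fun _ h => h.2) t ht).trans (le_max_right _ _)

theorem H1.differentiableAt_g (h1 : P.H1 μ x δ) (hδ : 0 < δ) (ω : Ω) :
    DifferentiableAt ℝ (fun y => P.g y ω) (x P.T ω) :=
  (h1.diff_g ω).differentiableAt (Metric.ball_mem_nhds _ hδ)

theorem inner_gradient_eq_fderiv {f : StateSpace n → ℝ} {y : StateSpace n} (v : StateSpace n) :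
    inner ℝ v (gradient f y) = fderiv ℝ f y v := by
  rw [real_inner_comm, gradient, InnerProductSpace.toDual_symm_apply]

theorem H1.aestronglyMeasurable_gradient (h0 : P.H0) (h1 : P.H1 μ x δ) (hδ : 0 < δ)
    (hx : AEStronglyMeasurable (x P.T) μ) :
    AEStronglyMeasurable (fun ω => gradient (fun y => P.g y ω) (x P.T ω)) μ := by
  refine (aemeasurable_of_inner fun v => ?_).aestronglyMeasurable
  have h₀ : AEMeasurable (fun ω => dirLim P.g (x P.T ω) v ω) μ :=
    aemeasurable_dirLim h0.meas_g hx.aemeasurable aemeasurable_const aemeasurable_id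
  refine h₀.congr (ae_of_all _ fun ω => ?_)
  beta_reduce
  rw [inner_gradient_eq_fderiv, dirLim_eq_fderiv (h1.differentiableAt_g hδ ω)]

/-- The pathwise adjoint arcs, for every parameter, bounded by `B` and measurable. -/
structure IsBoundedCostate (P : AffineProblem n Ω) (μ : Measure Ω) (w : ℝ → ℝ)
    (x q : ℝ → Ω → StateSpace n) (B : ℝ) : Prop where
  adjoint : ∀ ω, HasW11Deriv P.t₀ P.T (fun t => q t ω)
    (fun t => -ContinuousLinearMap.adjoint (P.dynJac (x t ω) (w t) ω) (q t ω))
  terminal : ∀ ω, -q P.T ω = gradient (fun y => P.g y ω) (x P.T ω)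
  bound : ∀ ω, ∀ t ∈ Icc P.t₀ P.T, ‖q t ω‖ ≤ B
  meas : ∀ t ∈ Icc P.t₀ P.T, AEStronglyMeasurable (q t) μ

/-- Reversing time turns the terminal value problem into a linear initial value problem with
operator norm at most `K`. Picard iteration gives existence and measurability in the parameter.
Grönwall and the bound on the terminal gradient give a `B` independent of the parameter. -/
theorem exists_isBoundedCostate [SFinite μ] (h0 : P.H0) (h1 : P.H1 μ x δ) (hδ : 0 < δ)
    (hφ : AEStronglyMeasurable P.φ μ) (hr : P.IsRegular w x) :
    ∃ q B, P.IsBoundedCostate μ w x q B := by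
  obtain ⟨c, K, D, hb⟩ := h0.exists_uniformBounds
  have hab : P.t₀ ≤ P.T := P.time_lt.le
  set σ : ℝ → ℝ := fun s => P.t₀ + P.T - s with hσ
  have hσmem : ∀ s ∈ Icc P.t₀ P.T, σ s ∈ Icc P.t₀ P.T := fun s hs =>
    ⟨by simp only [hσ]; linarith [hs.2], by simp only [hσ]; linarith [hs.1]⟩
  have hσc : Continuous σ := by fun_prop
  have hxσ : ∀ ω, ContinuousOn (fun s => x (σ s) ω) (Icc P.t₀ P.T) := fun ω =>
    (hr.adm.continuousOn ω).comp hσc.continuousOn hσmem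
  set G : ℝ → StateSpace n → Ω → StateSpace n := fun s y ω =>
    ContinuousLinearMap.adjoint (P.dynJac (x (σ s) ω) (w (σ s)) ω) y with hG
  set ψ : Ω → StateSpace n := fun ω => -gradient (fun y => P.g y ω) (x P.T ω) with hψ
  have hxmeas := h0.aestronglyMeasurable_arc hφ hr.control hr.adm
  have hψm : AEStronglyMeasurable ψ μ :=
    (h1.aestronglyMeasurable_gradient h0 hδ (hxmeas P.T (right_mem_Icc.2 hab))).neg
  have hwσ : Measurable fun s => w (σ s) := hr.control.1.comp hσc.measurable
  have hbound : ∀ s y ω, ‖G s y ω‖ ≤ K * ‖y‖ := fun s y ω =>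
    hb.norm_adjoint_dynJac_le (hr.control.2 _) _ _ _
  have hint : ∀ ω, ∀ y : ℝ → StateSpace n, ContinuousOn y (Icc P.t₀ P.T) →
      IntervalIntegrable (fun s => G s (y s) ω) volume P.t₀ P.T := by
    intro ω y hy
    obtain ⟨M, hM⟩ := isCompact_Icc.exists_bound_of_continuousOn hy
    refine intervalIntegrable_of_norm_le hab (C := K * M) ?_ fun t ht => ?_
    · refine (h0.aemeasurable_adjoint_dynJac ((hxσ ω).aemeasurable measurableSet_Icc)
        (hy.aemeasurable measurableSet_Icc) hwσ.aemeasurable aemeasurable_const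
        ?_ ?_).aestronglyMeasurable
      · filter_upwards [ae_restrict_mem measurableSet_Icc] with s hs using
          hr.diff₀ ω (hσmem s hs)
      · filter_upwards [ae_restrict_mem measurableSet_Icc] with s hs using
          hr.diff₁ ω (hσmem s hs)
    · exact (hbound t _ ω).trans (mul_le_mul_of_nonneg_left (hM t ht) hb.K_nonneg)
  have hlip : ∀ ω, ∀ s ∈ Icc P.t₀ P.T, ∀ y z, ‖G s y ω - G s z ω‖ ≤ K * ‖y - z‖ := by
    intro ω s _ y z
    simp only [hG, ← map_sub]
    exact hbound s (y - z) ω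
  have hmem : ∀ᵐ z ∂(volume.restrict (Icc P.t₀ P.T)).prod μ, z.1 ∈ Icc P.t₀ P.T :=
    Measure.quasiMeasurePreserving_fst.ae (ae_restrict_mem measurableSet_Icc)
  have hGm : ∀ y : ℝ → Ω → StateSpace n, AEStronglyMeasurable (fun z : ℝ × Ω => y z.1 z.2)
      ((volume.restrict (Icc P.t₀ P.T)).prod μ) →
      AEStronglyMeasurable (fun z : ℝ × Ω => G z.1 (y z.1 z.2) z.2)
        ((volume.restrict (Icc P.t₀ P.T)).prod μ) := by
    intro y hy
    have hx' := aestronglyMeasurable_uncurry_of_continuousOn (μ := μ) hab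
      (x := fun s ω => x (σ s) ω) (fun t ht => hxmeas (σ t) (hσmem t ht)) hxσ
    refine (h0.aemeasurable_adjoint_dynJac hx'.aemeasurable hy.aemeasurable
      (hwσ.comp measurable_fst).aemeasurable measurable_snd.aemeasurable
      ?_ ?_).aestronglyMeasurable
    · filter_upwards [hmem] with z hz using hr.diff₀ z.2 (hσmem z.1 hz)
    · filter_upwards [hmem] with z hz using hr.diff₁ z.2 (hσmem z.1 hz)
  have hex : ∀ ω, ∃ y : ℝ → StateSpace n, y P.t₀ = ψ ω ∧
      HasW11Deriv P.t₀ P.T y (fun s => G s (y s) ω) ∧ ∀ t ∈ Icc P.t₀ P.T,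
        Tendsto (fun k => picardIterate P.t₀ (fun s z => G s z ω) (ψ ω) k t) atTop (𝓝 (y t)) :=
    fun ω => exists_hasW11Deriv_tendsto_picardIterate hab (hint ω) (hlip ω) hb.K_nonneg (ψ ω)
  choose y hy0 hy hlim using hex
  have hσσ : ∀ t, σ (P.t₀ + P.T - t) = t := fun t => by simp only [hσ]; ring
  obtain ⟨C, hC, hgrad⟩ := h1.bound_grad_g
  refine ⟨fun t ω => y ω (σ t), C * Real.exp (K * (P.T - P.t₀)), fun ω => ?_, fun ω => ?_,
    fun ω t ht => ?_, fun t ht => ?_⟩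
  · have := (hy ω).reverse hab
    refine this.congr_ae hab (ae_of_all _ fun t => ?_)
    simp only [hG]
    rw [hσσ]
  · simp only [hσ, add_sub_cancel_right, hy0, hψ, neg_neg]
  · have h2 := (hy ω).norm_le_exp hb.K_nonneg le_rfl
      (ae_of_all _ fun s => by simpa using hbound s _ ω) (σ t) (hσmem t ht)
    rw [zero_mul, add_zero, hy0, hψ, norm_neg] at h2
    refine h2.trans (mul_le_mul (hgrad ω) ?_ (Real.exp_pos _).le hC.le)
    refine Real.exp_le_exp.2 (mul_le_mul_of_nonneg_left ?_ hb.K_nonneg)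
    linarith [(hσmem t ht).2]
  · exact aestronglyMeasurable_of_tendsto_ae atTop
      (fun k => aestronglyMeasurable_picardIterate hab hψm hint hGm k (σ t) (hσmem t ht))
      (ae_of_all _ fun ω => hlim ω (σ t) (hσmem t ht))

end Costate

section

variable [MeasurableSpace Ω] {μ : Measure Ω} {w : ℝ → ℝ} {x : ℝ → Ω → StateSpace n}

theorem IsBoundedCostate.continuousOn {q : ℝ → Ω → StateSpace n} {B : ℝ}
    (hq : P.IsBoundedCostate μ w x q B) (ω : Ω) :
    ContinuousOn (fun t => q t ω) (Icc P.t₀ P.T) :=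
  (hq.adjoint ω).continuousOn

theorem IsBoundedCostate.aestronglyMeasurable_uncurry {q : ℝ → Ω → StateSpace n} {B : ℝ}
    (hq : P.IsBoundedCostate μ w x q B) :
    AEStronglyMeasurable (fun z : ℝ × Ω => q z.1 z.2)
      ((volume.restrict (Icc P.t₀ P.T)).prod μ) :=
  aestronglyMeasurable_uncurry_of_continuousOn P.time_lt.le hq.meas hq.continuousOn

end

end AffineProblem

/-! ### Product rule, vanishing derivatives and bracket bounds -/

section Pairing

variable {E : Type*} [NormedAddCommGroup E] [InnerProductSpace ℝ E] [CompleteSpace E]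

/-- The product rule for the pairing of an arc with a `C¹` field along another arc. -/
theorem HasW11Deriv.inner_comp {a b C C' : ℝ} {p p' y y' : ℝ → E} {h : E → E} (hab : a ≤ b)
    (hp : HasW11Deriv a b p p') (hy : HasW11Deriv a b y y')
    (hp' : ∀ t ∈ Icc a b, ‖p' t‖ ≤ C) (hy' : ∀ t ∈ Icc a b, ‖y' t‖ ≤ C')
    (hh : ∀ t ∈ Icc a b, ContDiffAt ℝ 1 h (y t)) :
    HasW11Deriv a b (fun t => inner ℝ (p t) (h (y t)))
      (fun t => inner ℝ (p t) (fderiv ℝ h (y t) (y' t)) + inner ℝ (p' t) (h (y t))) := by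
  have hpair := hp.prodMk hy
  have hd : ∀ t ∈ Icc a b, ContDiffAt ℝ 1 (fun z : E × E => h z.2) (p t, y t) := fun t ht =>
    ContDiffAt.comp (p t, y t) (hh t ht) contDiff_snd.contDiffAt
  have key := hpair.contDiff_comp hab (C := max C C') (F := fun z : E × E => inner ℝ z.1 (h z.2))
    (fun t ht => max_le_max (hp' t ht) (hy' t ht))
    (fun t ht => contDiff_fst.contDiffAt.inner ℝ (hd t ht))
  refine key.congr_ae hab ?_
  filter_upwards [ae_restrict_mem measurableSet_Icc] with t ht
  rw [fderiv_inner_apply ℝ differentiableAt_fst ((hd t ht).differentiableAt one_ne_zero)]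
  have h1 : HasFDerivAt (fun z : E × E => h z.2)
      ((fderiv ℝ h (y t)).comp (ContinuousLinearMap.snd ℝ E E)) (p t, y t) :=
    HasFDerivAt.comp (p t, y t) ((hh t ht).differentiableAt one_ne_zero).hasFDerivAt
      hasFDerivAt_snd
  rw [h1.fderiv, fderiv_fst]
  simp

end Pairing

theorem HasW11Deriv.ae_eq_zero_of_eqOn_zero {X : Type*} [NormedAddCommGroup X] [NormedSpace ℝ X]
    [CompleteSpace X] {a b a' b' : ℝ} {z v : ℝ → X} (h : HasW11Deriv a b z v)
    (hsub : Ioo a' b' ⊆ Icc a b) (hz : ∀ t ∈ Ioo a' b', z t = 0) :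
    ∀ᵐ t ∂volume.restrict (Ioo a' b'), v t = 0 := by
  rw [ae_restrict_iff' measurableSet_Ioo]
  filter_upwards [h.ae_hasDerivAt] with t ht htab
  have hsub' : Ioo a' b' ⊆ Ioo a b := by
    rw [← interior_Icc (a := a)]; exact interior_maximal hsub isOpen_Ioo
  refine (ht (hsub' htab)).unique ?_
  refine (hasDerivAt_const t (0 : X)).congr_of_eventuallyEq ?_
  filter_upwards [Ioo_mem_nhds htab.1 htab.2] with s hs using hz s hs

theorem ContinuousOn.eqOn_zero_Ioo_of_ae {X : Type*} [TopologicalSpace X] [T2Space X] [Zero X]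
    {a b : ℝ} {z : ℝ → X} (hz : ContinuousOn z (Ioo a b))
    (h : ∀ᵐ t ∂volume.restrict (Ioo a b), z t = 0) : ∀ t ∈ Ioo a b, z t = 0 :=
  Measure.eqOn_open_of_ae_eq (g := fun _ => (0 : X)) h isOpen_Ioo hz continuousOn_const

section BracketBound

variable {E : Type*} [NormedAddCommGroup E] [NormedSpace ℝ E]

theorem norm_lieBracket_le {V W : E → E} {y : E} {K R : ℝ} (hK : 0 ≤ K)
    (hV : ‖V y‖ ≤ R) (hW : ‖W y‖ ≤ R) (hV' : ‖fderiv ℝ V y‖ ≤ K) (hW' : ‖fderiv ℝ W y‖ ≤ K) :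
    ‖VectorField.lieBracket ℝ V W y‖ ≤ 2 * (K * R) := by
  rw [VectorField.lieBracket]
  have h1 : ‖fderiv ℝ W y (V y)‖ ≤ K * R :=
    ((fderiv ℝ W y).le_opNorm _).trans (mul_le_mul hW' hV (norm_nonneg _) hK)
  have h2 : ‖fderiv ℝ V y (W y)‖ ≤ K * R :=
    ((fderiv ℝ V y).le_opNorm _).trans (mul_le_mul hV' hW (norm_nonneg _) hK)
  linarith [norm_sub_le (fderiv ℝ W y (V y)) (fderiv ℝ V y (W y))]

/-- The derivative in direction `v` is `W''(v,V) + W'V'v - V''(v,W) - V'W'v`: two terms of size `K *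
K` and two of size `C * R`. -/
theorem norm_fderiv_lieBracket_le {V W : E → E} {y : E} {K R C : ℝ} (hK : 0 ≤ K) (hC : 0 ≤ C)
    (hVs : ContDiffAt ℝ 2 V y) (hWs : ContDiffAt ℝ 2 W y)
    (hV : ‖V y‖ ≤ R) (hW : ‖W y‖ ≤ R) (hV' : ‖fderiv ℝ V y‖ ≤ K) (hW' : ‖fderiv ℝ W y‖ ≤ K)
    (hV'' : ‖fderiv ℝ (fderiv ℝ V) y‖ ≤ C) (hW'' : ‖fderiv ℝ (fderiv ℝ W) y‖ ≤ C) :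
    ‖fderiv ℝ (VectorField.lieBracket ℝ V W) y‖ ≤ 2 * (K * K + C * R) := by
  have hR : 0 ≤ R := (norm_nonneg _).trans hV
  have dV := (hVs.differentiableAt two_ne_zero).hasFDerivAt
  have dW := (hWs.differentiableAt two_ne_zero).hasFDerivAt
  have ddV := ((hVs.fderiv_right (m := 1) (by norm_num)).differentiableAt one_ne_zero).hasFDerivAt
  have ddW := ((hWs.fderiv_right (m := 1) (by norm_num)).differentiableAt one_ne_zero).hasFDerivAt
  have key : HasFDerivAt (VectorField.lieBracket ℝ V W) _ y :=
    (ddW.clm_apply dV).sub (ddV.clm_apply dW)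
  rw [key.fderiv]
  refine ContinuousLinearMap.opNorm_le_bound _ (by positivity) fun v => ?_
  have e1 : ‖fderiv ℝ W y (fderiv ℝ V y v)‖ ≤ K * (K * ‖v‖) :=
    ((fderiv ℝ W y).le_opNorm _).trans (mul_le_mul hW' (((fderiv ℝ V y).le_opNorm _).trans
      (mul_le_mul_of_nonneg_right hV' (norm_nonneg _))) (norm_nonneg _) hK)
  have e2 : ‖fderiv ℝ V y (fderiv ℝ W y v)‖ ≤ K * (K * ‖v‖) :=
    ((fderiv ℝ V y).le_opNorm _).trans (mul_le_mul hV' (((fderiv ℝ W y).le_opNorm _).trans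
      (mul_le_mul_of_nonneg_right hW' (norm_nonneg _))) (norm_nonneg _) hK)
  have e3 : ‖fderiv ℝ (fderiv ℝ W) y v (V y)‖ ≤ C * ‖v‖ * R :=
    ((fderiv ℝ (fderiv ℝ W) y v).le_opNorm _).trans
      (mul_le_mul (((fderiv ℝ (fderiv ℝ W) y).le_opNorm _).trans
        (mul_le_mul_of_nonneg_right hW'' (norm_nonneg _))) hV (norm_nonneg _) (by positivity))
  have e4 : ‖fderiv ℝ (fderiv ℝ V) y v (W y)‖ ≤ C * ‖v‖ * R :=
    ((fderiv ℝ (fderiv ℝ V) y v).le_opNorm _).trans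
      (mul_le_mul (((fderiv ℝ (fderiv ℝ V) y).le_opNorm _).trans
        (mul_le_mul_of_nonneg_right hV'' (norm_nonneg _))) hW (norm_nonneg _) (by positivity))
  simp only [sub_apply, add_apply,
    ContinuousLinearMap.comp_apply, ContinuousLinearMap.flip_apply]
  refine (norm_sub_le _ _).trans ?_
  linarith [norm_add_le (fderiv ℝ W y (fderiv ℝ V y v)) (fderiv ℝ (fderiv ℝ W) y v (V y)),
    norm_add_le (fderiv ℝ V y (fderiv ℝ W y v)) (fderiv ℝ (fderiv ℝ V) y v (W y))]

end BracketBound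

/-! ### Averaged pairings and their derivatives -/

namespace AffineProblem

variable {n : ℕ} {Ω : Type*} {P : AffineProblem n Ω}

/-- The Lie bracket, in the state variable, of two parametrized vector fields. -/
noncomputable def bracket (V W : StateSpace n → Ω → StateSpace n) (y : StateSpace n) (ω : Ω) :
    StateSpace n :=
  VectorField.lieBracket ℝ (fun z => V z ω) (fun z => W z ω) y

variable [MeasurableSpace Ω] {μ : Measure Ω} {w : ℝ → ℝ} {x q : ℝ → Ω → StateSpace n} {B : ℝ}

/-- The average of the pairing of a field along the arcs with the adjoint arcs. -/
noncomputable def avg (μ : Measure Ω) (x q : ℝ → Ω → StateSpace n)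
    (h : StateSpace n → Ω → StateSpace n) (t : ℝ) : ℝ :=
  ∫ ω, inner ℝ (q t ω) (h (x t ω) ω) ∂μ

/-- A field that has quadratic growth in the initial state along the arcs and coincides there with
a jointly measurable field. -/
structure IsTame (P : AffineProblem n Ω) (μ : Measure Ω) (x : ℝ → Ω → StateSpace n)
    (h : StateSpace n → Ω → StateSpace n) : Prop where
  bound : ∃ C : ℝ, 0 ≤ C ∧ ∀ᵐ ω ∂μ, ∀ t ∈ Icc P.t₀ P.T,
    ‖h (x t ω) ω‖ ≤ C * (1 + ‖P.φ ω‖) ^ 2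
  meas : ∃ k : StateSpace n → Ω → StateSpace n, (Measurable fun z : StateSpace n × Ω => k z.1 z.2) ∧
    ∀ ω, ∀ t ∈ Icc P.t₀ P.T, h (x t ω) ω = k (x t ω) ω

theorem integrable_sq_of_memLp [IsFiniteMeasure μ] (hφ : MemLp P.φ 2 μ) :
    Integrable (fun ω => (1 + ‖P.φ ω‖) ^ 2) μ :=
  ((memLp_const (1 : ℝ)).add hφ.norm).integrable_sq

theorem IsBoundedCostate.norm_inner_le (hq : P.IsBoundedCostate μ w x q B) {ω : Ω} {t : ℝ}
    (ht : t ∈ Icc P.t₀ P.T) {v : StateSpace n} {R : ℝ} (hv : ‖v‖ ≤ R) :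
    ‖inner ℝ (q t ω) v‖ ≤ B * R :=
  (norm_inner_le_norm _ _).trans (mul_le_mul (hq.bound ω t ht) hv (norm_nonneg _)
    ((norm_nonneg _).trans (hq.bound ω t ht)))

theorem IsTame.integrable [IsFiniteMeasure μ] {h : StateSpace n → Ω → StateSpace n}
    (hh : P.IsTame μ x h) (h0 : P.H0) (hφ : MemLp P.φ 2 μ) (hr : P.IsRegular w x)
    (hq : P.IsBoundedCostate μ w x q B) {t : ℝ} (ht : t ∈ Icc P.t₀ P.T) :
    Integrable (fun ω => inner ℝ (q t ω) (h (x t ω) ω)) μ := by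
  obtain ⟨C, hC, hbd⟩ := hh.bound
  obtain ⟨k, hk, hhk⟩ := hh.meas
  refine Integrable.mono' (((integrable_sq_of_memLp hφ).const_mul C).const_mul B) ?_ ?_
  · have hx := h0.aestronglyMeasurable_arc hφ.aestronglyMeasurable hr.control hr.adm t ht
    have hm : AEMeasurable (fun ω => k (x t ω) ω) μ :=
      hk.comp_aemeasurable (f := fun ω => (x t ω, ω)) (hx.aemeasurable.prodMk aemeasurable_id)
    refine ((hq.meas t ht).inner hm.aestronglyMeasurable (𝕜 := ℝ)).congr
      (ae_of_all _ fun ω => ?_)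
    simp only [hhk ω t ht]
  · filter_upwards [hbd] with ω hω using hq.norm_inner_le ht (hω t ht)

theorem IsTame.integrable_prod [IsFiniteMeasure μ] {h : StateSpace n → Ω → StateSpace n}
    (hh : P.IsTame μ x h) (h0 : P.H0) (hφ : MemLp P.φ 2 μ) (hr : P.IsRegular w x)
    (hq : P.IsBoundedCostate μ w x q B) :
    Integrable (fun z : ℝ × Ω => inner ℝ (q z.1 z.2) (h (x z.1 z.2) z.2))
      ((volume.restrict (Icc P.t₀ P.T)).prod μ) := by
  obtain ⟨C, hC, hbd⟩ := hh.bound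
  obtain ⟨k, hk, hhk⟩ := hh.meas
  have hmem : ∀ᵐ z ∂(volume.restrict (Icc P.t₀ P.T)).prod μ, z.1 ∈ Icc P.t₀ P.T :=
    Measure.quasiMeasurePreserving_fst.ae (ae_restrict_mem measurableSet_Icc)
  have hbd' : ∀ᵐ z ∂(volume.restrict (Icc P.t₀ P.T)).prod μ, ∀ t ∈ Icc P.t₀ P.T,
      ‖h (x t z.2) z.2‖ ≤ C * (1 + ‖P.φ z.2‖) ^ 2 :=
    Measure.quasiMeasurePreserving_snd.ae hbd
  have hdom : Integrable (fun z : ℝ × Ω => B * (C * (1 + ‖P.φ z.2‖) ^ 2))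
      ((volume.restrict (Icc P.t₀ P.T)).prod μ) :=
    (((integrable_sq_of_memLp hφ).const_mul C).const_mul B).comp_snd _
  refine Integrable.mono' hdom ?_ ?_
  · have hx := h0.aestronglyMeasurable_uncurry_arc hφ.aestronglyMeasurable hr.control hr.adm
    have hm : AEMeasurable (fun z : ℝ × Ω => k (x z.1 z.2) z.2)
        ((volume.restrict (Icc P.t₀ P.T)).prod μ) :=
      hk.comp_aemeasurable (f := fun z : ℝ × Ω => (x z.1 z.2, z.2))
        (hx.aemeasurable.prodMk measurable_snd.aemeasurable)
    refine (hq.aestronglyMeasurable_uncurry.inner hm.aestronglyMeasurable (𝕜 := ℝ)).congr ?_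
    filter_upwards [hmem] with z hz
    rw [hhk z.2 z.1 hz]
  · filter_upwards [hmem, hbd'] with z hz hb using hq.norm_inner_le hz (hb z.1 hz)

/-- The time derivative of a pairing along the arcs is given by Lie brackets. -/
theorem hasW11Deriv_inner_field (h0 : P.H0) (hr : P.IsRegular w x)
    (hq : P.IsBoundedCostate μ w x q B) {h : StateSpace n → Ω → StateSpace n} {ω : Ω}
    (hs : ∀ t ∈ Icc P.t₀ P.T, ContDiffAt ℝ 1 (fun y => h y ω) (x t ω)) :
    HasW11Deriv P.t₀ P.T (fun t => inner ℝ (q t ω) (h (x t ω) ω))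
      (fun t => inner ℝ (q t ω) (bracket P.f₀ h (x t ω) ω) +
        w t * inner ℝ (q t ω) (bracket P.f₁ h (x t ω) ω)) := by
  obtain ⟨c, K, D, hb⟩ := h0.exists_uniformBounds
  obtain ⟨M, hM, hxM⟩ := hb.exists_arc_le
  have key := HasW11Deriv.inner_comp (h := fun y => h y ω) P.time_lt.le (hq.adjoint ω)
    (hr.adm.2 ω).2 (C := K * B) (C' := c * (M * (1 + ‖P.φ ω‖)))
    (fun t ht => by
      rw [norm_neg]
      exact (hb.norm_adjoint_dynJac_le (hr.control.2 t) _ _ _).trans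
        (mul_le_mul_of_nonneg_left (hq.bound ω t ht) hb.K_nonneg))
    (fun t ht => (hb.dyn_le _ (hr.control.2 t) _ _).trans
      (mul_le_mul_of_nonneg_left (hxM w x hr.control hr.adm ω t ht) hb.c_nonneg)) hs
  refine key.congr_ae P.time_lt.le ?_
  filter_upwards [ae_restrict_mem measurableSet_Icc] with t ht
  -- Moving the Jacobian off `q` leaves `q · (h'(f₀ + w f₁) - (f₀' + w f₁') h)`, which regroups into
  -- the two brackets.
  rw [inner_neg_left, ContinuousLinearMap.adjoint_inner_left,
    dynJac_eq (hr.diff₀ ω ht) (hr.diff₁ ω ht)]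
  simp only [bracket, VectorField.lieBracket, dyn, map_add, map_smul, inner_add_right,
    inner_sub_right, inner_smul_right, add_apply,
    smul_apply]
  ring

/-- The averaged pairing is absolutely continuous, with derivative given by Lie brackets. -/
theorem hasW11Deriv_avg [IsFiniteMeasure μ] (h0 : P.H0) (hφ : MemLp P.φ 2 μ)
    (hr : P.IsRegular w x) (hq : P.IsBoundedCostate μ w x q B)
    {h : StateSpace n → Ω → StateSpace n}
    (hs : ∀ ω, ∀ t ∈ Icc P.t₀ P.T, ContDiffAt ℝ 1 (fun y => h y ω) (x t ω))
    (ht : P.IsTame μ x h) (ht₀ : P.IsTame μ x (bracket P.f₀ h))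
    (ht₁ : P.IsTame μ x (bracket P.f₁ h)) :
    HasW11Deriv P.t₀ P.T (avg μ x q h)
      (fun t => avg μ x q (bracket P.f₀ h) t + w t * avg μ x q (bracket P.f₁ h) t) := by
  obtain ⟨c, K, D, hb⟩ := h0.exists_uniformBounds
  have hab := P.time_lt.le
  set d : ℝ → Ω → ℝ := fun t ω => inner ℝ (q t ω) (bracket P.f₀ h (x t ω) ω) +
    w t * inner ℝ (q t ω) (bracket P.f₁ h (x t ω) ω) with hd
  -- Joint integrability lets Fubini average the pathwise integral identities, so nothing is
  -- differentiated under the integral sign.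
  have hdint : Integrable (fun z : ℝ × Ω => d z.1 z.2)
      ((volume.restrict (Icc P.t₀ P.T)).prod μ) := by
    refine (ht₀.integrable_prod h0 hφ hr hq).add ?_
    refine (ht₁.integrable_prod h0 hφ hr hq).bdd_mul (c := D)
      (hr.control.1.comp measurable_fst).aestronglyMeasurable (ae_of_all _ fun z => ?_)
    exact hb.control_le _ (hr.control.2 z.1)
  have hdavg : ∀ t ∈ Icc P.t₀ P.T, ∫ ω, d t ω ∂μ =
      avg μ x q (bracket P.f₀ h) t + w t * avg μ x q (bracket P.f₁ h) t := by
    intro t htm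
    simp only [hd, avg]
    rw [integral_add (ht₀.integrable h0 hφ hr hq htm)
      ((ht₁.integrable h0 hφ hr hq htm).const_mul _), integral_const_mul]
  have hdavg' : (fun t => ∫ ω, d t ω ∂μ) =ᵐ[volume.restrict (Icc P.t₀ P.T)]
      fun t => avg μ x q (bracket P.f₀ h) t + w t * avg μ x q (bracket P.f₁ h) t := by
    filter_upwards [ae_restrict_mem measurableSet_Icc] with t htm using hdavg t htm
  refine HasW11Deriv.congr_ae ⟨?_, fun t htm => ?_⟩ hab hdavg'
  · rw [intervalIntegrable_iff_integrableOn_Ioc_of_le hab,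
      ← integrableOn_Icc_iff_integrableOn_Ioc]
    exact hdint.integral_prod_left
  · have hsub : Ioc P.t₀ t ⊆ Icc P.t₀ P.T := fun s hs => ⟨hs.1.le, hs.2.trans htm.2⟩
    have hdint' := hdint.mono_measure
      (prod_restrict_le_of_subset volume μ measurableSet_Ioc hsub)
    have e1 : ∀ ω, inner ℝ (q t ω) (h (x t ω) ω) =
        inner ℝ (q P.t₀ ω) (h (x P.t₀ ω) ω) + ∫ s in Ioc P.t₀ t, d s ω := fun ω => by
      rw [← intervalIntegral.integral_of_le htm.1]
      exact (hasW11Deriv_inner_field h0 hr hq (hs ω)).2 t htm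
    have e2 : avg μ x q h t = avg μ x q h P.t₀ + ∫ ω, (∫ s in Ioc P.t₀ t, d s ω) ∂μ := by
      simp only [avg]
      rw [integral_congr_ae (ae_of_all _ e1), integral_add
        (ht.integrable h0 hφ hr hq (left_mem_Icc.2 hab)) hdint'.integral_prod_right]
    rw [e2, intervalIntegral.integral_of_le htm.1, ← integral_integral_swap (f := d) hdint']

end AffineProblem

/-! ### Bracket fields along the arcs and the singular-arc equation -/

namespace AffineProblem

variable {n : ℕ} {Ω : Type*} {P : AffineProblem n Ω} {w : ℝ → ℝ} {x : ℝ → Ω → StateSpace n}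

theorem IsRegular.contDiffAt_bracket (hr : P.IsRegular w x) (ω : Ω) {t : ℝ}
    (ht : t ∈ Icc P.t₀ P.T) :
    ContDiffAt ℝ 1 (fun y => bracket P.f₀ P.f₁ y ω) (x t ω) :=
  (hr.smooth₀ ω t ht).lieBracket_vectorField (hr.smooth₁ ω t ht) (by norm_num)

theorem IsRegular.bracketLim_eventuallyEq (hr : P.IsRegular w x) (ω : Ω) {t : ℝ}
    (ht : t ∈ Icc P.t₀ P.T) :
    (fun y => bracketLim P.f₀ P.f₁ y ω) =ᶠ[𝓝 (x t ω)] fun y => bracket P.f₀ P.f₁ y ω := by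
  filter_upwards [(hr.smooth₀ ω t ht).eventually (by simp),
    (hr.smooth₁ ω t ht).eventually (by simp)] with y h₀ h₁
  exact bracketLim_eq_lieBracket (h₀.differentiableAt two_ne_zero)
    (h₁.differentiableAt two_ne_zero)

theorem IsRegular.bracketLim_bracketLim_eq (hr : P.IsRegular w x) (ω : Ω) {t : ℝ}
    (ht : t ∈ Icc P.t₀ P.T) {V : StateSpace n → Ω → StateSpace n}
    (hV : DifferentiableAt ℝ (fun y => V y ω) (x t ω)) :
    bracket V (bracket P.f₀ P.f₁) (x t ω) ω =
      bracketLim V (bracketLim P.f₀ P.f₁) (x t ω) ω := by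
  have he := hr.bracketLim_eventuallyEq ω ht
  rw [bracketLim, dirLim_congr he ((hr.contDiffAt_bracket ω ht).differentiableAt one_ne_zero),
    dirLim_eq_fderiv hV, he.eq_of_nhds]
  rfl

variable [MetricSpace Ω] [TopologicalSpace.SeparableSpace Ω] [MeasurableSpace Ω]
  {μ : Measure Ω} {δ : ℝ}

/-- Fields grow linearly along the arcs and their first two derivatives are bounded there, so
`[f₀,f₁]` and its derivative grow linearly. A further bracket multiplies that derivative by a field
of linear growth: degree two. -/
theorem H1.isTame_fields (h0 : P.H0) (h1 : P.H1 μ x δ) (hr : P.IsRegular w x) :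
    P.IsTame μ x P.f₁ ∧ P.IsTame μ x (bracket P.f₀ P.f₁) ∧ P.IsTame μ x (bracket P.f₁ P.f₁) ∧
      P.IsTame μ x (bracket P.f₀ (bracket P.f₀ P.f₁)) ∧
      P.IsTame μ x (bracket P.f₁ (bracket P.f₀ P.f₁)) := by
  have : SecondCountableTopology Ω := UniformSpace.secondCountable_of_separable Ω
  obtain ⟨c, K, D, hb⟩ := h0.exists_uniformBounds
  obtain ⟨M, hM, hxM⟩ := hb.exists_arc_le
  obtain ⟨C, hC, hsnd⟩ := h1.exists_snd_bound hr
  have hc := hb.c_nonneg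
  have hK := hb.K_nonneg
  have m₀ := h0.measurable_f₀
  have m₁ := h0.measurable_f₁
  have mL := measurable_bracketLim m₀ m₁
  have hR₀ : ∀ ω, ∀ t ∈ Icc P.t₀ P.T, ‖P.f₀ (x t ω) ω‖ ≤ c * M * (1 + ‖P.φ ω‖) :=
    fun ω t ht => (hb.f₀_le _ _).trans (by
      rw [mul_assoc]; exact mul_le_mul_of_nonneg_left (hxM w x hr.control hr.adm ω t ht) hc)
  have hR₁ : ∀ ω, ∀ t ∈ Icc P.t₀ P.T, ‖P.f₁ (x t ω) ω‖ ≤ c * M * (1 + ‖P.φ ω‖) :=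
    fun ω t ht => (hb.f₁_le _ _).trans (by
      rw [mul_assoc]; exact mul_le_mul_of_nonneg_left (hxM w x hr.control hr.adm ω t ht) hc)
  have hlin : ∀ ω (A : ℝ), 0 ≤ A → A * (1 + ‖P.φ ω‖) ≤ A * (1 + ‖P.φ ω‖) ^ 2 := fun ω A hA =>
    mul_le_mul_of_nonneg_left (by nlinarith [norm_nonneg (P.φ ω)]) hA
  have hbr : ∀ ω, ∀ t ∈ Icc P.t₀ P.T,
      ‖bracket P.f₀ P.f₁ (x t ω) ω‖ ≤ 2 * (K * (c * M * (1 + ‖P.φ ω‖))) := fun ω t ht =>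
    norm_lieBracket_le hK (hR₀ ω t ht) (hR₁ ω t ht) (hb.norm_fderiv_f₀_le _ ω)
      (hb.norm_fderiv_f₁_le _ ω)
  have hbb : ∀ V : StateSpace n → Ω → StateSpace n,
      (∀ ω, ∀ t ∈ Icc P.t₀ P.T, ‖V (x t ω) ω‖ ≤ c * M * (1 + ‖P.φ ω‖)) →
      (∀ ω y, ‖fderiv ℝ (fun z => V z ω) y‖ ≤ K) →
      (∀ ω, ∀ t ∈ Icc P.t₀ P.T, DifferentiableAt ℝ (fun z => V z ω) (x t ω)) →
      (Measurable fun z : StateSpace n × Ω => V z.1 z.2) →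
      P.IsTame μ x (bracket V (bracket P.f₀ P.f₁)) := by
    intro V hV hV' hVd hVm
    refine ⟨⟨2 * (K * K + C * (c * M)) * (c * M) + K * (2 * (K * (c * M))), by positivity, ?_⟩,
      ⟨_, measurable_bracketLim hVm mL, fun ω t ht =>
        hr.bracketLim_bracketLim_eq ω ht (hVd ω t ht)⟩⟩
    -- Second derivatives are bounded only over the support, which has full measure because `Ω` is
    -- second countable.
    filter_upwards [Measure.support_mem_ae] with ω hω t ht
    set r := 1 + ‖P.φ ω‖ with hrdef
    have hr1 : 1 ≤ r := by simp [hrdef]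
    have hr0 : 0 ≤ r := zero_le_one.trans hr1
    have hD := norm_fderiv_lieBracket_le hK hC (hr.smooth₀ ω t ht) (hr.smooth₁ ω t ht)
      (hR₀ ω t ht) (hR₁ ω t ht) (hb.norm_fderiv_f₀_le _ ω) (hb.norm_fderiv_f₁_le _ ω)
      (hsnd ω hω t ht).1 (hsnd ω hω t ht).2
    have e1 : ‖fderiv ℝ (fun y => bracket P.f₀ P.f₁ y ω) (x t ω) (V (x t ω) ω)‖ ≤
        2 * (K * K + C * (c * M * r)) * (c * M * r) :=
      (ContinuousLinearMap.le_opNorm _ _).trans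
        (mul_le_mul hD (hV ω t ht) (norm_nonneg _) (by positivity))
    have e2 : ‖fderiv ℝ (fun y => V y ω) (x t ω) (bracket P.f₀ P.f₁ (x t ω) ω)‖ ≤
        K * (2 * (K * (c * M * r))) :=
      (ContinuousLinearMap.le_opNorm _ _).trans
        (mul_le_mul (hV' ω _) (hbr ω t ht) (norm_nonneg _) hK)
    have e3 : ‖bracket V (bracket P.f₀ P.f₁) (x t ω) ω‖ ≤
        2 * (K * K + C * (c * M * r)) * (c * M * r) + K * (2 * (K * (c * M * r))) :=
      (norm_sub_le _ _).trans (add_le_add e1 e2)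
    refine e3.trans ?_
    have hrr : r ≤ r ^ 2 := by nlinarith
    calc _ = 2 * (K * K) * (c * M) * r + 2 * (C * (c * M)) * (c * M) * r ^ 2
          + K * (2 * (K * (c * M))) * r := by ring
      _ ≤ 2 * (K * K) * (c * M) * r ^ 2 + 2 * (C * (c * M)) * (c * M) * r ^ 2
          + K * (2 * (K * (c * M))) * r ^ 2 := by gcongr
      _ = _ := by ring
  refine ⟨⟨⟨c * M, by positivity, ae_of_all _ fun ω t ht => ?_⟩, P.f₁, m₁, fun _ _ _ => rfl⟩,
    ⟨⟨2 * (K * (c * M)), by positivity, ae_of_all _ fun ω t ht => ?_⟩, _, mL, fun ω t ht =>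
      (hr.bracketLim_eventuallyEq ω ht).eq_of_nhds.symm⟩,
    ⟨⟨0, le_rfl, ae_of_all _ fun ω t ht => ?_⟩, fun _ _ => 0, measurable_const,
      fun ω t ht => ?_⟩, ?_, ?_⟩
  · exact (hR₁ ω t ht).trans (hlin ω _ (by positivity))
  · refine ((hbr ω t ht).trans_eq ?_).trans (hlin ω _ (by positivity))
    ring
  · simp [bracket]
  · simp [bracket]
  · exact hbb P.f₀ hR₀ (fun ω y => hb.norm_fderiv_f₀_le y ω) (fun ω t ht => hr.diff₀ ω ht) m₀
  · exact hbb P.f₁ hR₁ (fun ω y => hb.norm_fderiv_f₁_le y ω) (fun ω t ht => hr.diff₁ ω ht) m₁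

/-- The singular-arc equation for the pathwise adjoint arcs. -/
theorem singular_of_isBoundedCostate [IsFiniteMeasure μ] (h0 : P.H0) (h1 : P.H1 μ x δ)
    (hφ : MemLp P.φ 2 μ) (hr : P.IsRegular w x) {q : ℝ → Ω → StateSpace n} {B : ℝ}
    (hq : P.IsBoundedCostate μ w x q B) {a b : ℝ} (hab : Ioo a b ⊆ Icc P.t₀ P.T)
    (hz : ∀ t ∈ Ioo a b, P.switching μ x q t = 0) :
    ∀ᵐ t ∂volume.restrict (Ioo a b),
      Integrable (P.bracket₀ x q t) μ ∧ Integrable (P.bracket₁ x q t) μ ∧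
      (∫ ω, P.bracket₀ x q t ω ∂μ) + w t * (∫ ω, P.bracket₁ x q t ω ∂μ) = 0 := by
  obtain ⟨t1, t01, t11, t001, t101⟩ := h1.isTame_fields h0 hr
  have d1 := hasW11Deriv_avg h0 hφ hr hq
    (fun ω t ht => (hr.smooth₁ ω t ht).of_le one_le_two) t1 t01 t11
  have d2 := hasW11Deriv_avg h0 hφ hr hq (h := bracket P.f₀ P.f₁)
    (fun ω t ht => hr.contDiffAt_bracket ω ht) t01 t001 t101
  -- The control term disappears because `[f₁,f₁] = 0`.
  have z1 : ∀ᵐ t ∂volume.restrict (Ioo a b), avg μ x q (bracket P.f₀ P.f₁) t = 0 := by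
    filter_upwards [d1.ae_eq_zero_of_eqOn_zero hab hz] with t ht
    simpa [avg, bracket] using ht
  have z2 := (d2.continuousOn.mono hab).eqOn_zero_Ioo_of_ae z1
  filter_upwards [d2.ae_eq_zero_of_eqOn_zero hab z2, ae_restrict_mem measurableSet_Ioo]
    with t ht htm
  exact ⟨t001.integrable h0 hφ hr hq (hab htm), t101.integrable h0 hφ hr hq (hab htm), ht⟩

end AffineProblem

/-! ### First variation along convex perturbations of the control -/

theorem HasFDerivAt.tendsto_inv_smul_remainder {E F : Type*} [NormedAddCommGroup E]
    [NormedSpace ℝ E] [NormedAddCommGroup F] [NormedSpace ℝ F] {f : E → F} {f' : E →L[ℝ] F}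
    {x : E} (hf : HasFDerivAt f f' x) {y : ℕ → E} {ε : ℕ → ℝ} {C : ℝ}
    (hε : Tendsto ε atTop (𝓝 0)) (hy : ∀ k, ‖y k - x‖ ≤ C * ‖ε k‖) :
    Tendsto (fun k => (ε k)⁻¹ • (f (y k) - f x - f' (y k - x))) atTop (𝓝 0) := by
  have hO : (fun k => y k - x) =O[atTop] ε := Asymptotics.IsBigO.of_bound C
    (Eventually.of_forall hy)
  have h0 : Tendsto (fun k => y k - x) atTop (𝓝 0) := hO.trans_tendsto hε
  have hyx : Tendsto y atTop (𝓝 x) := by simpa using h0.add_const x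
  exact ((hf.isLittleO.comp_tendsto hyx).trans_isBigO hO).tendsto_inv_smul_nhds_zero

/-- The Lipschitz estimate bounds `deriv` at every interior time, whether or not the derivative
exists; the `W^{1,1}` norms are written with `deriv`. -/
theorem HasW11Deriv.norm_deriv_le {X : Type*} [NormedAddCommGroup X] [NormedSpace ℝ X]
    {a b C : ℝ} {z v : ℝ → X} (h : HasW11Deriv a b z v) (hC : ∀ t ∈ Icc a b, ‖v t‖ ≤ C)
    {t : ℝ} (ht : t ∈ Ioo a b) : ‖deriv z t‖ ≤ C := by
  have ht' := Ioo_subset_Icc_self ht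
  refine norm_deriv_le_of_lip' ((norm_nonneg _).trans (hC t ht')) ?_
  filter_upwards [Icc_mem_nhds ht.1 ht.2] with s hs using h.norm_sub_le hC ht' hs

namespace AffineProblem

variable {n : ℕ} {Ω : Type*} {P : AffineProblem n Ω} {w v : ℝ → ℝ} {x : ℝ → Ω → StateSpace n}

/-- The control `w + ε (v - w)`. -/
def convexControl (w v : ℝ → ℝ) (ε : ℝ) (t : ℝ) : ℝ := w t + ε * (v t - w t)

theorem IsStrictControl.convexControl (hw : P.IsStrictControl w) (hv : P.IsStrictControl v)
    {ε : ℝ} (hε : ε ∈ Icc (0 : ℝ) 1) : P.IsStrictControl (convexControl w v ε) := by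
  refine ⟨hw.1.add ((hv.1.sub hw.1).const_mul ε), fun t => ?_⟩
  have := (convex_Icc P.umin P.umax).add_smul_sub_mem (hw.2 t) (hv.2 t) hε
  simpa [AffineProblem.convexControl] using this

theorem UniformBounds.abs_sub_le {c K D : ℝ} (hb : P.UniformBounds c K D)
    (hw : P.IsStrictControl w) (hv : P.IsStrictControl v) (t : ℝ) : |v t - w t| ≤ 2 * D := by
  have h1 := hb.control_le _ (hw.2 t)
  have h2 := hb.control_le _ (hv.2 t)
  linarith [abs_sub (v t) (w t)]

variable [MeasurableSpace Ω] {μ : Measure Ω} {q : ℝ → Ω → StateSpace n} {B : ℝ}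

/-- The first variation of the pairing of the adjoint arc with the state at the final time. -/
theorem tendsto_inner_terminal (h0 : P.H0) (hr : P.IsRegular w x)
    (hq : P.IsBoundedCostate μ w x q B) (hv : P.IsStrictControl v) {ε : ℕ → ℝ}
    (hε : ∀ k, ε k ∈ Ioc (0 : ℝ) 1) (hε0 : Tendsto ε atTop (𝓝 0))
    {y : ℕ → ℝ → Ω → StateSpace n}
    (hy : ∀ k, P.IsAdmissible (convexControl w v (ε k)) (y k)) (ω : Ω) :
    Tendsto (fun k => (ε k)⁻¹ * inner ℝ (q P.T ω) (y k P.T ω - x P.T ω)) atTop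
      (𝓝 (∫ t in P.t₀..P.T, (v t - w t) * inner ℝ (q t ω) (P.f₁ (x t ω) ω))) := by
  obtain ⟨c, K, D, hb⟩ := h0.exists_uniformBounds
  obtain ⟨C, hC, hst⟩ := hb.exists_stability
  have hab := P.time_lt.le
  set r := 1 + ‖P.φ ω‖ with hr_def
  have hr0 : 0 ≤ r := by positivity
  have hK := hb.K_nonneg
  have hD := hb.D_nonneg
  have hs : ∀ k, P.IsStrictControl (convexControl w v (ε k)) := fun k =>
    hr.control.convexControl hv ⟨(hε k).1.le, (hε k).2⟩
  have hdiff : ∀ k t, |convexControl w v (ε k) t - w t| ≤ ε k * (2 * D) := fun k t => by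
    rw [convexControl, add_sub_cancel_left, abs_mul, abs_of_pos (hε k).1]
    exact mul_le_mul_of_nonneg_left (hb.abs_sub_le hr.control hv t) (hε k).1.le
  have hest : ∀ k, ∀ t ∈ Icc P.t₀ P.T, ‖y k t ω - x t ω‖ ≤ C * (ε k * (2 * D)) * r ∧
      ‖P.dyn (y k t ω) (convexControl w v (ε k) t) ω - P.dyn (x t ω) (w t) ω‖ ≤
        C * (ε k * (2 * D)) * r := fun k t ht =>
    hst w _ x (y k) _ (mul_nonneg (hε k).1.le (by positivity)) hr.control (hs k) (hdiff k)
      hr.adm (hy k) ω t ht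
  -- The velocity of `q · (y - x)`: the adjoint equation subtracts the linearized dynamics and only
  -- the remainder survives.
  set F : ℕ → ℝ → ℝ := fun k t =>
    inner ℝ (q t ω) (P.dyn (y k t ω) (convexControl w v (ε k) t) ω - P.dyn (x t ω) (w t) ω -
      P.dynJac (x t ω) (w t) ω (y k t ω - x t ω)) with hF
  have hW : ∀ k, HasW11Deriv P.t₀ P.T
      (fun t => inner ℝ (q t ω) (y k t ω - x t ω)) (F k) := by
    intro k
    have key := HasW11Deriv.inner_comp (h := id) hab (hq.adjoint ω)
      (((hy k).2 ω).2.sub (hr.adm.2 ω).2) (C := K * B) (C' := C * (ε k * (2 * D)) * r)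
      (fun t ht => by
        rw [norm_neg]
        exact (hb.norm_adjoint_dynJac_le (hr.control.2 t) _ _ _).trans
          (mul_le_mul_of_nonneg_left (hq.bound ω t ht) hK))
      (fun t ht => (hest k t ht).2) (fun t _ => contDiff_id.contDiffAt)
    refine key.congr_ae hab (ae_of_all _ fun t => ?_)
    simp only [hF, fderiv_id, id, ContinuousLinearMap.coe_id', inner_neg_left,
      ContinuousLinearMap.adjoint_inner_left, inner_sub_right, map_sub]
    ring
  -- The pairing starts from zero because both arcs have initial state `φ ω`.
  have hterm : ∀ k, inner ℝ (q P.T ω) (y k P.T ω - x P.T ω) = ∫ t in P.t₀..P.T, F k t := by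
    intro k
    have := (hW k).2 P.T (right_mem_Icc.2 hab)
    simpa [(hr.adm.2 ω).1, ((hy k).2 ω).1] using this
  have hlim : Tendsto (fun k => ∫ t in P.t₀..P.T, (ε k)⁻¹ * F k t) atTop
      (𝓝 (∫ t in P.t₀..P.T, (v t - w t) * inner ℝ (q t ω) (P.f₁ (x t ω) ω))) := by
    refine intervalIntegral.tendsto_integral_filter_of_dominated_convergence
      (fun _ => B * (C * (2 * D) * r + K * (C * (2 * D) * r)))
      (Eventually.of_forall fun k => ?_) (Eventually.of_forall fun k => ae_of_all _ fun t ht => ?_)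
      intervalIntegrable_const (ae_of_all _ fun t ht => ?_)
    · rw [uIoc_of_le hab]
      exact ((hW k).1.const_mul _).1.aestronglyMeasurable
    · rw [uIoc_of_le hab] at ht
      have ht' := Ioc_subset_Icc_self ht
      have hεk := (hε k).1
      obtain ⟨e1, e2⟩ := hest k t ht'
      have e3 : ‖P.dynJac (x t ω) (w t) ω (y k t ω - x t ω)‖ ≤
          K * (C * (ε k * (2 * D)) * r) :=
        (ContinuousLinearMap.le_opNorm _ _).trans
          (mul_le_mul (hb.norm_dynJac_le (hr.control.2 t) _ _) e1 (norm_nonneg _) hK)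
      have e4 := hq.norm_inner_le (ω := ω) ht' ((norm_sub_le _ _).trans (add_le_add e2 e3))
      rw [norm_mul, norm_inv, Real.norm_eq_abs, abs_of_pos hεk, inv_mul_le_iff₀ hεk]
      refine e4.trans_eq ?_
      ring
    · rw [uIoc_of_le hab] at ht
      have ht' := Ioc_subset_Icc_self ht
      have hyx : ∀ k, ‖y k t ω - x t ω‖ ≤ C * (2 * D) * r * ‖ε k‖ := fun k => by
        rw [Real.norm_eq_abs, abs_of_pos (hε k).1]
        refine (hest k t ht').1.trans_eq ?_
        ring
      have hfd : HasFDerivAt (fun z => P.dyn z (w t) ω) (P.dynJac (x t ω) (w t) ω) (x t ω) :=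
        (hasFDerivAt_dyn (hr.diff₀ ω ht') (hr.diff₁ ω ht') (w t)).differentiableAt.hasFDerivAt
      have l1 := hfd.tendsto_inv_smul_remainder hε0 hyx
      have l2 : Tendsto (fun k => P.f₁ (y k t ω) ω) atTop (𝓝 (P.f₁ (x t ω) ω)) := by
        rw [tendsto_iff_norm_sub_tendsto_zero]
        refine squeeze_zero (fun _ => norm_nonneg _) (fun k => (hb.f₁_lip _ _ ω).trans
          (mul_le_mul_of_nonneg_left (hyx k) hK)) ?_
        simpa using ((hε0.norm).const_mul (C * (2 * D) * r)).const_mul K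
      have l3 := (tendsto_const_nhds (x := q t ω)).inner (𝕜 := ℝ) (l1.add (l2.const_smul (v t - w t)))
      rw [zero_add, inner_smul_right] at l3
      refine l3.congr fun k => ?_
      have hεk := (hε k).1.ne'
      -- A Taylor remainder at fixed control, which is `o(ε)`, plus the explicit control increment.
      -- This split is exact because the dynamics are affine in the control.
      have e : P.dyn (y k t ω) (convexControl w v (ε k) t) ω - P.dyn (x t ω) (w t) ω -
          P.dynJac (x t ω) (w t) ω (y k t ω - x t ω) =
          (P.dyn (y k t ω) (w t) ω - P.dyn (x t ω) (w t) ω -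
            P.dynJac (x t ω) (w t) ω (y k t ω - x t ω)) +
            ε k • ((v t - w t) • P.f₁ (y k t ω) ω) := by
        simp only [dyn, convexControl, add_smul, mul_smul]
        abel
      simp only [hF]
      rw [e, ← inner_smul_right, smul_add, smul_smul, inv_mul_cancel₀ hεk, one_smul]
  refine hlim.congr fun k => ?_
  rw [intervalIntegral.integral_const_mul, hterm]

end AffineProblem

/-! ### First-order condition and bang-bang law -/

namespace AffineProblem

variable {n : ℕ} {Ω : Type*} {P : AffineProblem n Ω} {w v : ℝ → ℝ} {x : ℝ → Ω → StateSpace n}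
  [MetricSpace Ω] [MeasurableSpace Ω] {μ : Measure Ω} {q : ℝ → Ω → StateSpace n} {B δ : ℝ}

/-- Optimality among the strict controls that are uniformly close. -/
def IsUniformLocalMin (P : AffineProblem n Ω) (μ : Measure Ω) (w : ℝ → ℝ)
    (x : ℝ → Ω → StateSpace n) : Prop :=
  ∃ η : ℝ, 0 < η ∧ ∀ v y, P.IsStrictControl v → P.IsAdmissible v y → (∀ t, |v t - w t| ≤ η) →
    P.cost μ x ≤ P.cost μ y

/-- By the terminal condition the linear part of `g` is `-q(T) · (y - x)`, whence the minus sign;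
the Taylor remainder is `o(ε)`. -/
theorem tendsto_cost_quotient (h0 : P.H0) (h1 : P.H1 μ x δ) (hδ : 0 < δ)
    (hr : P.IsRegular w x) (hq : P.IsBoundedCostate μ w x q B) (hv : P.IsStrictControl v)
    {ε : ℕ → ℝ} (hε : ∀ k, ε k ∈ Ioc (0 : ℝ) 1) (hε0 : Tendsto ε atTop (𝓝 0))
    {y : ℕ → ℝ → Ω → StateSpace n}
    (hy : ∀ k, P.IsAdmissible (convexControl w v (ε k)) (y k))
    {A : ℝ} {ω : Ω} (hA : ∀ k, ‖y k P.T ω - x P.T ω‖ ≤ A * ‖ε k‖) :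
    Tendsto (fun k => (ε k)⁻¹ * (P.g (y k P.T ω) ω - P.g (x P.T ω) ω)) atTop
      (𝓝 (-∫ t in P.t₀..P.T, (v t - w t) * inner ℝ (q t ω) (P.f₁ (x t ω) ω))) := by
  have l1 := tendsto_inner_terminal h0 hr hq hv hε hε0 hy ω
  have l2 := (h1.differentiableAt_g hδ ω).hasFDerivAt.tendsto_inv_smul_remainder hε0 hA
  have l3 := l2.sub l1
  rw [zero_sub] at l3
  refine l3.congr fun k => ?_
  rw [← inner_gradient_eq_fderiv, ← hq.terminal ω, inner_neg_right, real_inner_comm, smul_eq_mul]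
  ring

/-- The first-order necessary condition along convex variations of the control. -/
theorem IsUniformLocalMin.integral_le_zero [IsFiniteMeasure μ] (hmin : P.IsUniformLocalMin μ w x)
    (h0 : P.H0) (h1 : P.H1 μ x δ) (hδ : 0 < δ) (hφ : MemLp P.φ 2 μ)
    (hr : P.IsRegular w x) (hq : P.IsBoundedCostate μ w x q B) (ht : P.IsTame μ x P.f₁)
    (hv : P.IsStrictControl v) :
    Integrable (fun t => (v t - w t) * P.switching μ x q t) (volume.restrict (Icc P.t₀ P.T)) ∧
      ∫ t in Icc P.t₀ P.T, (v t - w t) * P.switching μ x q t ≤ 0 := by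
  obtain ⟨η, hη, hopt⟩ := hmin
  obtain ⟨c, K, D, hb⟩ := h0.exists_uniformBounds
  obtain ⟨C, hC, hst⟩ := hb.exists_stability
  obtain ⟨k, hk, hgl⟩ := h0.lip_g
  obtain ⟨Mg, hMg, hgb⟩ := h0.bound_g
  have hab := P.time_lt.le
  have hTm : P.T ∈ Icc P.t₀ P.T := right_mem_Icc.2 hab
  have hD := hb.D_nonneg
  set ε : ℕ → ℝ := fun j => 1 / ((j : ℝ) + 1) with hεdef
  have hε : ∀ j, ε j ∈ Ioc (0 : ℝ) 1 := fun j => by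
    refine ⟨by positivity, ?_⟩
    simp only [hεdef]
    rw [div_le_one (by positivity)]
    have : (0 : ℝ) ≤ j := by positivity
    linarith
  have hε0 : Tendsto ε atTop (𝓝 0) := tendsto_one_div_add_atTop_nhds_zero_nat
  have hs : ∀ j, P.IsStrictControl (convexControl w v (ε j)) := fun j =>
    hr.control.convexControl hv ⟨(hε j).1.le, (hε j).2⟩
  choose y hy using fun j => h0.exists_isAdmissible (hs j)
  have hdiff : ∀ j t, |convexControl w v (ε j) t - w t| ≤ ε j * (2 * D) := fun j t => by
    rw [convexControl, add_sub_cancel_left, abs_mul, abs_of_pos (hε j).1]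
    exact mul_le_mul_of_nonneg_left (hb.abs_sub_le hr.control hv t) (hε j).1.le
  have hA : ∀ ω j, ‖y j P.T ω - x P.T ω‖ ≤ C * (2 * D) * (1 + ‖P.φ ω‖) * ‖ε j‖ := fun ω j => by
    rw [Real.norm_eq_abs, abs_of_pos (hε j).1]
    refine (hst w _ x (y j) _ (mul_nonneg (hε j).1.le (by positivity)) hr.control (hs j)
      (hdiff j) hr.adm (hy j) ω P.T hTm).1.trans_eq ?_
    ring
  have hgm : ∀ z : Ω → StateSpace n, AEStronglyMeasurable z μ →
      Integrable (fun ω => P.g (z ω) ω) μ := fun z hz => by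
    have hm : AEMeasurable (fun ω => P.g (z ω) ω) μ :=
      h0.meas_g.comp_aemeasurable (f := fun ω => (z ω, ω)) (hz.aemeasurable.prodMk aemeasurable_id)
    exact Integrable.of_bound hm.aestronglyMeasurable Mg (ae_of_all _ fun ω => hgb _ _)
  have hgx := hgm _ (h0.aestronglyMeasurable_arc hφ.aestronglyMeasurable hr.control hr.adm P.T hTm)
  have hgy := fun j => hgm _
    (h0.aestronglyMeasurable_arc hφ.aestronglyMeasurable (hs j) (hy j) P.T hTm)
  set L : Ω → ℝ := fun ω =>
    ∫ t in P.t₀..P.T, (v t - w t) * inner ℝ (q t ω) (P.f₁ (x t ω) ω) with hL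
  have hlim : Tendsto
      (fun j => ∫ ω, (ε j)⁻¹ * (P.g (y j P.T ω) ω - P.g (x P.T ω) ω) ∂μ) atTop
      (𝓝 (∫ ω, -L ω ∂μ)) := by
    refine tendsto_integral_of_dominated_convergence
      (fun ω => k * (C * (2 * D) * (1 + ‖P.φ ω‖)))
      (fun j => (((hgy j).sub hgx).const_mul _).aestronglyMeasurable) ?_
      (fun j => ae_of_all _ fun ω => ?_) (ae_of_all _ fun ω => ?_)
    · have : Integrable (fun ω => 1 + ‖P.φ ω‖) μ :=
        (integrable_const 1).add (hφ.integrable one_le_two).norm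
      exact (this.const_mul _).const_mul k
    · rw [norm_mul, norm_inv, Real.norm_eq_abs (ε j), abs_of_pos (hε j).1,
        inv_mul_le_iff₀ (hε j).1, Real.norm_eq_abs]
      refine (hgl _ _ ω).trans ((mul_le_mul_of_nonneg_left (hA ω j)
        (zero_le_one.trans hk)).trans_eq ?_)
      rw [Real.norm_eq_abs, abs_of_pos (hε j).1]
      ring
    · exact tendsto_cost_quotient h0 h1 hδ hr hq hv hε hε0 hy (hA ω)
  -- Optimality is available only once the perturbed control lies within `η` of `w`, hence
  -- eventually.
  have hpos : ∀ᶠ j in atTop,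
      0 ≤ ∫ ω, (ε j)⁻¹ * (P.g (y j P.T ω) ω - P.g (x P.T ω) ω) ∂μ := by
    have hsmall : Tendsto (fun j => ε j * (2 * D)) atTop (𝓝 0) := by
      simpa using hε0.mul_const (2 * D)
    filter_upwards [hsmall.eventually (ge_mem_nhds hη)] with j hj
    rw [integral_const_mul, integral_sub (hgy j) hgx]
    refine mul_nonneg (inv_nonneg.2 (hε j).1.le) (sub_nonneg.2 ?_)
    exact hopt _ (y j) (hs j) (hy j) fun t => (hdiff j t).trans hj
  have hLle : ∫ ω, L ω ∂μ ≤ 0 := by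
    have := ge_of_tendsto hlim hpos
    rw [integral_neg] at this
    linarith
  have hint : Integrable (fun z : ℝ × Ω => (v z.1 - w z.1) *
      inner ℝ (q z.1 z.2) (P.f₁ (x z.1 z.2) z.2)) ((volume.restrict (Icc P.t₀ P.T)).prod μ) := by
    refine (ht.integrable_prod h0 hφ hr hq).bdd_mul (c := 2 * D)
      ((hv.1.sub hr.control.1).comp measurable_fst).aestronglyMeasurable (ae_of_all _ fun z => ?_)
    exact hb.abs_sub_le hr.control hv z.1
  have hsw : ∀ t, ∫ ω, (v t - w t) * inner ℝ (q t ω) (P.f₁ (x t ω) ω) ∂μ =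
      (v t - w t) * P.switching μ x q t := fun t => integral_const_mul _ _
  refine ⟨?_, ?_⟩
  · have := hint.integral_prod_left
    simpa only [hsw] using this
  · have e := integral_integral_swap
      (f := fun t ω => (v t - w t) * inner ℝ (q t ω) (P.f₁ (x t ω) ω)) hint
    simp only [hsw] at e
    rw [e]
    refine le_of_eq_of_le (integral_congr_ae (ae_of_all _ fun ω => ?_)) hLle
    simp only [hL]
    rw [intervalIntegral.integral_of_le hab, integral_Icc_eq_integral_Ioc]

/-- Test with the control that follows the sign of `Ψ`. Then `(v - w) Ψ` is nonnegative with
nonpositive integral, so it vanishes almost everywhere, and `w = v` wherever `Ψ ≠ 0`. -/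
theorem IsUniformLocalMin.bang [IsFiniteMeasure μ] (hmin : P.IsUniformLocalMin μ w x)
    (h0 : P.H0) (h1 : P.H1 μ x δ) (hδ : 0 < δ) (hφ : MemLp P.φ 2 μ)
    (hr : P.IsRegular w x) (hq : P.IsBoundedCostate μ w x q B) (ht : P.IsTame μ x P.f₁) :
    ∀ᵐ t ∂volume.restrict (Icc P.t₀ P.T),
      (0 < P.switching μ x q t → w t = P.umax) ∧ (P.switching μ x q t < 0 → w t = P.umin) := by
  have hSm : AEStronglyMeasurable (P.switching μ x q) (volume.restrict (Icc P.t₀ P.T)) :=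
    (ht.integrable_prod h0 hφ hr hq).integral_prod_left.aestronglyMeasurable
  -- The comparison control must be Borel, so it is built from a measurable version of `Ψ`.
  set S := hSm.mk _ with hS
  have hSmeas : Measurable S := hSm.stronglyMeasurable_mk.measurable
  set v : ℝ → ℝ := fun t => if 0 < S t then P.umax else if S t < 0 then P.umin else w t with hv
  have hvs : P.IsStrictControl v := by
    refine ⟨Measurable.ite (measurableSet_lt measurable_const hSmeas) measurable_const
      (Measurable.ite (measurableSet_lt hSmeas measurable_const) measurable_const hr.control.1),
      fun t => ?_⟩
    simp only [hv]
    split_ifs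
    · exact right_mem_Icc.2 P.control_lt.le
    · exact left_mem_Icc.2 P.control_lt.le
    · exact hr.control.2 t
  obtain ⟨hint, hle⟩ := hmin.integral_le_zero h0 h1 hδ hφ hr hq ht hvs
  have hnn : ∀ᵐ t ∂volume.restrict (Icc P.t₀ P.T), 0 ≤ (v t - w t) * P.switching μ x q t := by
    filter_upwards [hSm.ae_eq_mk] with t hSt
    rw [hSt]
    simp only [hv]
    have := hr.control.2 t
    split_ifs with h2 h3
    · exact mul_nonneg (sub_nonneg.2 this.2) h2.le
    · exact mul_nonneg_of_nonpos_of_nonpos (sub_nonpos.2 this.1) h3.le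
    · simp
  have hzero := (integral_eq_zero_iff_of_nonneg_ae hnn hint).1
    (le_antisymm hle (integral_nonneg_of_ae hnn))
  filter_upwards [hzero, hSm.ae_eq_mk] with t hz hSt
  simp only [Pi.zero_apply, mul_eq_zero] at hz
  refine ⟨fun hp => ?_, fun hn => ?_⟩
  · have h2 := hz.resolve_right hp.ne'
    rw [hSt] at hp
    simp only [hv, hS, if_pos hp] at h2
    linarith
  · have h2 := hz.resolve_right hn.ne
    rw [hSt] at hn
    simp only [hv, hS, if_neg hn.not_gt, if_pos hn] at h2
    linarith

end AffineProblem

/-! ### From local minimizers to uniform optimality, and uniqueness of the adjoint arc -/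

theorem lintegral_add_lintegral_Icc_le {a b : ℝ} {f g : ℝ → ℝ≥0∞} {R : ℝ} (hR : 0 ≤ R)
    (hf : ∀ t ∈ Ioo a b, f t ≤ ENNReal.ofReal R) (hg : ∀ t ∈ Ioo a b, g t ≤ ENNReal.ofReal R) :
    (∫⁻ t in Icc a b, f t) + ∫⁻ t in Icc a b, g t ≤ ENNReal.ofReal (2 * (R * (b - a))) := by
  have key : ∀ f : ℝ → ℝ≥0∞, (∀ t ∈ Ioo a b, f t ≤ ENNReal.ofReal R) →
      ∫⁻ t in Icc a b, f t ≤ ENNReal.ofReal (R * (b - a)) := by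
    intro f hf
    rw [← restrict_Ioo_eq_restrict_Icc]
    refine (setLIntegral_mono measurable_const hf).trans ?_
    rw [setLIntegral_const, Real.volume_Ioo, ← ENNReal.ofReal_mul hR]
  rw [ENNReal.ofReal_mul zero_le_two, ENNReal.ofReal_ofNat, two_mul]
  exact add_le_add (key f hf) (key g hg)

namespace AffineProblem

variable {n : ℕ} {Ω : Type*} {P : AffineProblem n Ω} {u w : ℝ → ℝ} {x : ℝ → Ω → StateSpace n}
  [MeasurableSpace Ω] {μ : Measure Ω} {q : ℝ → Ω → StateSpace n} {B δ : ℝ}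

/-- Stability bounds the distance of the arcs and of their velocities by `C η (1 + ‖x₀‖)`; the
common initial state makes this uniform in the parameter. -/
theorem IsW11LocalMin.isUniformLocalMin [MetricSpace Ω] (hmin : P.IsW11LocalMin μ u x) (h0 : P.H0)
    {x₀ : StateSpace n} (hφ : ∀ ω, P.φ ω = x₀) (hw : P.IsStrictControl w)
    (hx : P.IsAdmissible w x) : P.IsUniformLocalMin μ w x := by
  obtain ⟨-, e, he, hopt⟩ := hmin
  obtain ⟨c, K, D, hb⟩ := h0.exists_uniformBounds
  obtain ⟨C, hC, hst⟩ := hb.exists_stability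
  have hτ : 0 ≤ P.T - P.t₀ := sub_nonneg.2 P.time_lt.le
  set A := 2 * (C * (1 + ‖x₀‖) * (P.T - P.t₀)) with hA
  have hA0 : 0 ≤ A := by positivity
  -- The added `1` keeps the radius meaningful when `A = 0`.
  refine ⟨e / (A + 1), by positivity, fun v y hv hy hvw => hopt v y hy fun ω _ => ?_⟩
  set η := e / (A + 1) with hη
  have hη0 : 0 ≤ η := by positivity
  have hAη : A * η ≤ e := by
    rw [hη, mul_div_assoc', div_le_iff₀ (by positivity)]
    nlinarith
  have hst' := hst w v x y η hη0 hw hv hvw hx hy ω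
  rw [hφ ω] at hst'
  have hR : 0 ≤ C * η * (1 + ‖x₀‖) := by positivity
  refine (lintegral_add_lintegral_Icc_le (R := C * η * (1 + ‖x₀‖)) hR
    (fun t ht => ?_) (fun t ht => ?_)).trans ?_
  · rw [← ofReal_norm, norm_sub_rev]
    exact ENNReal.ofReal_le_ofReal (hst' t (Ioo_subset_Icc_self ht)).1
  · rw [← ofReal_norm]
    refine ENNReal.ofReal_le_ofReal (((hx.2 ω).2.sub (hy.2 ω).2).norm_deriv_le (fun s hs => ?_) ht)
    rw [norm_sub_rev]
    exact (hst' s hs).2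
  · refine ENNReal.ofReal_le_ofReal (le_trans (le_of_eq ?_) hAη)
    rw [hA]; ring

/-- The stability bound is proportional to `1 + ‖φ ω‖`, whose `L²` norm `N` is finite, so uniform
closeness of controls gives closeness of `L²`-valued curves. -/
theorem IsW11LocalMinL2.isUniformLocalMin [IsFiniteMeasure μ] (hmin : P.IsW11LocalMinL2 μ u x)
    (h0 : P.H0) (hφ : MemLp P.φ 2 μ) (hw : P.IsStrictControl w)
    (hx : P.IsAdmissible w x) : P.IsUniformLocalMin μ w x := by
  obtain ⟨-, e, he, hopt⟩ := hmin
  obtain ⟨c, K, D, hb⟩ := h0.exists_uniformBounds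
  obtain ⟨C, hC, hst⟩ := hb.exists_stability
  have hτ : 0 ≤ P.T - P.t₀ := sub_nonneg.2 P.time_lt.le
  have hmem : MemLp (fun ω => 1 + ‖P.φ ω‖) 2 μ := (memLp_const (1 : ℝ)).add hφ.norm
  set N := (eLpNorm (fun ω => 1 + ‖P.φ ω‖) 2 μ).toReal with hN
  have hN' : eLpNorm (fun ω => 1 + ‖P.φ ω‖) 2 μ = ENNReal.ofReal N :=
    (ENNReal.ofReal_toReal hmem.2.ne).symm
  have hN0 : 0 ≤ N := ENNReal.toReal_nonneg
  set A := 2 * (C * N * (P.T - P.t₀)) with hA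
  have hA0 : 0 ≤ A := by positivity
  refine ⟨e / (A + 1), by positivity, fun v y hv hy hvw => hopt v y hy ?_⟩
  set η := e / (A + 1) with hη
  have hη0 : 0 ≤ η := by positivity
  have hAη : A * η ≤ e := by
    rw [hη, mul_div_assoc', div_le_iff₀ (by positivity)]
    nlinarith
  have hst' := hst w v x y η hη0 hw hv hvw hx hy
  have hCη : 0 ≤ C * η := by positivity
  have hnorm : ∀ z : Ω → StateSpace n, (∀ ω, ‖z ω‖ ≤ C * η * (1 + ‖P.φ ω‖)) →
      eLpNorm z 2 μ ≤ ENNReal.ofReal (C * η * N) := fun z hz => by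
    refine (eLpNorm_le_mul_eLpNorm_of_ae_le_mul (g := fun ω => 1 + ‖P.φ ω‖)
      (ae_of_all _ fun ω => ?_) 2).trans_eq (c := ENNReal.ofReal (C * η * N))
        (b := ENNReal.ofReal (C * η) * eLpNorm (fun ω => 1 + ‖P.φ ω‖) 2 μ) ?_
    · refine (hz ω).trans_eq ?_
      rw [Real.norm_of_nonneg (by positivity)]
    · rw [hN', ← ENNReal.ofReal_mul hCη]
  refine (lintegral_add_lintegral_Icc_le (R := C * η * N) (by positivity)
    (fun t ht => hnorm _ fun ω => ?_) (fun t ht => hnorm _ fun ω => ?_)).trans ?_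
  · rw [norm_sub_rev]
    exact (hst' ω t (Ioo_subset_Icc_self ht)).1
  · refine ((hx.2 ω).2.sub (hy.2 ω).2).norm_deriv_le (fun s hs => ?_) ht
    rw [norm_sub_rev]
    exact (hst' ω s hs).2
  · refine ENNReal.ofReal_le_ofReal (le_trans (le_of_eq ?_) hAη)
    rw [hA]; ring

/-- The characterization depends only on the class of the adjoint arc at each time and on the
class of the control. -/
theorem ControlCharacterization.congr {p : ℝ → Ω → StateSpace n}
    (h : P.ControlCharacterization μ w x q)
    (huw : u =ᵐ[volume.restrict (Icc P.t₀ P.T)] w)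
    (hpq : ∀ t ∈ Icc P.t₀ P.T, p t =ᵐ[μ] q t) : P.ControlCharacterization μ u x p := by
  have hs : ∀ t ∈ Icc P.t₀ P.T, (fun ω => inner ℝ (p t ω) (P.f₁ (x t ω) ω)) =ᵐ[μ]
      fun ω => inner ℝ (q t ω) (P.f₁ (x t ω) ω) := fun t ht => by
    filter_upwards [hpq t ht] with ω hω
    rw [hω]
  have hsw : ∀ t ∈ Icc P.t₀ P.T, P.switching μ x p t = P.switching μ x q t := fun t ht =>
    integral_congr_ae (hs t ht)
  refine ⟨fun t ht => (h.switching_integrable t ht).congr (hs t ht).symm, ?_, fun a b hab hz => ?_⟩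
  · filter_upwards [h.bang, huw, ae_restrict_mem measurableSet_Icc] with t hb hu ht
    rw [hsw t ht, hu]
    exact hb
  · have hz' : ∀ t ∈ Ioo a b, P.switching μ x q t = 0 := fun t ht => by
      rw [← hsw t (hab ht)]; exact hz t ht
    filter_upwards [h.singular a b hab hz', ae_restrict_of_ae_restrict_of_subset hab huw,
      ae_restrict_mem measurableSet_Ioo] with t hb hu ht
    have e0 : P.bracket₀ x p t =ᵐ[μ] P.bracket₀ x q t := by
      filter_upwards [hpq t (hab ht)] with ω hω
      simp only [bracket₀, hω]
    have e1 : P.bracket₁ x p t =ᵐ[μ] P.bracket₁ x q t := by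
      filter_upwards [hpq t (hab ht)] with ω hω
      simp only [bracket₁, hω]
    refine ⟨hb.1.congr e0.symm, hb.2.1.congr e1.symm, ?_⟩
    rw [integral_congr_ae e0, integral_congr_ae e1, hu]
    exact hb.2.2

theorem IsUniformLocalMin.controlCharacterization [MetricSpace Ω] [TopologicalSpace.SeparableSpace Ω]
    [IsFiniteMeasure μ] (hmin : P.IsUniformLocalMin μ w x)
    (h0 : P.H0) (h1 : P.H1 μ x δ) (hδ : 0 < δ) (hφ : MemLp P.φ 2 μ)
    (hr : P.IsRegular w x) (hq : P.IsBoundedCostate μ w x q B) :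
    P.ControlCharacterization μ w x q := by
  have ht := (h1.isTame_fields h0 hr).1
  exact ⟨fun t htm => ht.integrable h0 hφ hr hq htm, hmin.bang h0 h1 hδ hφ hr hq ht,
    fun a b hab hz => singular_of_isBoundedCostate h0 h1 hφ hr hq hab hz⟩

/-- Uniqueness of the adjoint arc for a known initial state. -/
theorem IsCostate.eq_of_isBoundedCostate [MetricSpace Ω] {p : ℝ → Ω → StateSpace n} (hp : P.IsCostate μ u x p)
    (h0 : P.H0) (hw : P.IsStrictControl w) (huw : u =ᵐ[volume.restrict (Icc P.t₀ P.T)] w)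
    (hq : P.IsBoundedCostate μ w x q B) {ω : Ω} (hω : ω ∈ μ.support) :
    ∀ t ∈ Icc P.t₀ P.T, p t ω = q t ω := by
  obtain ⟨c, K, D, hb⟩ := h0.exists_uniformBounds
  have hab := P.time_lt.le
  have h1 : HasW11Deriv P.t₀ P.T (fun t => p t ω)
      (fun t => -ContinuousLinearMap.adjoint (P.dynJac (x t ω) (w t) ω) (p t ω)) := by
    refine (hp.adjoint_eq ω hω).congr_ae hab ?_
    filter_upwards [huw] with t ht
    rw [ht]
  -- After reversal the shared terminal condition becomes a zero initial value for the difference.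
  have h2 := (h1.sub (hq.adjoint ω)).reverse hab
  have h3 := h2.eqOn_zero hb.K_nonneg (ae_of_all _ fun t => ?_) ?_
  · intro t ht
    have := h3 (P.t₀ + P.T - t) ⟨by linarith [ht.2], by linarith [ht.1]⟩
    rw [sub_sub_cancel] at this
    exact sub_eq_zero.1 this
  · refine le_of_eq_of_le (congrArg norm ?_) (hb.norm_adjoint_dynJac_le
      (hw.2 (P.t₀ + P.T - t)) (x (P.t₀ + P.T - t) ω) ω
      (p (P.t₀ + P.T - t) ω - q (P.t₀ + P.T - t) ω))
    rw [map_sub]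
    abel
  · rw [add_sub_cancel_left, ← neg_inj, neg_sub, neg_zero, sub_eq_zero, ← neg_inj,
      hq.terminal, hp.terminal ω hω]

end AffineProblem

/-! ### Uniqueness of the `L²`-valued adjoint arc -/

namespace AffineProblem

variable {n : ℕ} {Ω : Type*} {P : AffineProblem n Ω} {u w : ℝ → ℝ} {x : ℝ → Ω → StateSpace n}
  [MeasurableSpace Ω] {μ : Measure Ω} {q : ℝ → Ω → StateSpace n} {B : ℝ}

/-- The pathwise adjoint arcs solve the adjoint equation in the weak sense in `L²`. -/
theorem IsBoundedCostate.integral_inner_sub [IsFiniteMeasure μ] (h0 : P.H0)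
    (hφ : AEStronglyMeasurable P.φ μ) (hr : P.IsRegular w x)
    (hq : P.IsBoundedCostate μ w x q B) (W : Lp (StateSpace n) 2 μ) {t : ℝ}
    (ht : t ∈ Icc P.t₀ P.T) :
    (IntervalIntegrable (fun s => ∫ ω, inner ℝ (W ω)
        (-ContinuousLinearMap.adjoint (P.dynJac (x s ω) (w s) ω) (q s ω)) ∂μ) volume t P.T) ∧
    ∫ ω, inner ℝ (W ω) (q P.T ω - q t ω) ∂μ = ∫ s in t..P.T, ∫ ω, inner ℝ (W ω)
        (-ContinuousLinearMap.adjoint (P.dynJac (x s ω) (w s) ω) (q s ω)) ∂μ := by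
  obtain ⟨c, K, D, hb⟩ := h0.exists_uniformBounds
  have hT : P.T ∈ Icc P.t₀ P.T := right_mem_Icc.2 P.time_lt.le
  have hsub : Ioc t P.T ⊆ Icc P.t₀ P.T := fun s hs => ⟨ht.1.trans hs.1.le, hs.2⟩
  set a : ℝ → Ω → StateSpace n := fun s ω =>
    -ContinuousLinearMap.adjoint (P.dynJac (x s ω) (w s) ω) (q s ω) with ha
  have hmem : ∀ᵐ z ∂(volume.restrict (Icc P.t₀ P.T)).prod μ, z.1 ∈ Icc P.t₀ P.T :=
    Measure.quasiMeasurePreserving_fst.ae (ae_restrict_mem measurableSet_Icc)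
  have hint : Integrable (fun z : ℝ × Ω => inner ℝ (W z.2) (a z.1 z.2))
      ((volume.restrict (Icc P.t₀ P.T)).prod μ) := by
    have hWint : Integrable (fun ω => ‖W ω‖) μ := ((Lp.memLp W).integrable one_le_two).norm
    refine Integrable.mono' ((hWint.mul_const (K * B)).comp_snd _) ?_ ?_
    · have hx := h0.aestronglyMeasurable_uncurry_arc hφ hr.control hr.adm
      have hm := (h0.aemeasurable_adjoint_dynJac hx.aemeasurable
        hq.aestronglyMeasurable_uncurry.aemeasurable
        (hr.control.1.comp measurable_fst).aemeasurable measurable_snd.aemeasurable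
        (by filter_upwards [hmem] with z hz using hr.diff₀ z.2 hz)
        (by filter_upwards [hmem] with z hz using hr.diff₁ z.2 hz)).aestronglyMeasurable
      exact ((Lp.aestronglyMeasurable W).comp_snd).inner (𝕜 := ℝ) hm.neg
    · filter_upwards [hmem] with z hz
      refine (norm_inner_le_norm _ _).trans (mul_le_mul_of_nonneg_left ?_ (norm_nonneg _))
      rw [norm_neg]
      exact (hb.norm_adjoint_dynJac_le (hr.control.2 _) _ _ _).trans
        (mul_le_mul_of_nonneg_left (hq.bound _ _ hz) hb.K_nonneg)
  have hint' := hint.mono_measure (prod_restrict_le_of_subset volume μ measurableSet_Ioc hsub)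
  refine ⟨?_, ?_⟩
  · rw [intervalIntegrable_iff_integrableOn_Ioc_of_le ht.2]
    exact hint'.integral_prod_left
  · rw [intervalIntegral.integral_of_le ht.2,
      integral_integral_swap (f := fun s ω => inner ℝ (W ω) (a s ω)) hint']
    refine integral_congr_ae (ae_of_all _ fun ω => ?_)
    beta_reduce
    rw [(hq.adjoint ω).sub_eq ht hT, ← intervalIntegral.integral_of_le ht.2]
    have := (innerSL ℝ (W ω)).intervalIntegral_comp_comm
      ((hq.adjoint ω).intervalIntegrable_sub ht hT)
    simpa only [innerSL_apply_apply] using this.symm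

/-- Uniqueness of the adjoint arc with values in `L²`. -/
theorem IsCostateL2.ae_eq_of_isBoundedCostate [IsFiniteMeasure μ]
    {p : ℝ → Lp (StateSpace n) 2 μ} (hp : P.IsCostateL2 μ u x p) (h0 : P.H0)
    (hφ : AEStronglyMeasurable P.φ μ) (hr : P.IsRegular w x)
    (huw : u =ᵐ[volume.restrict (Icc P.t₀ P.T)] w)
    (hq : P.IsBoundedCostate μ w x q B) : ∀ t ∈ Icc P.t₀ P.T, p t =ᵐ[μ] q t := by
  obtain ⟨c, K, D, hb⟩ := h0.exists_uniformBounds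
  have hK := hb.K_nonneg
  have hab := P.time_lt.le
  have hT : P.T ∈ Icc P.t₀ P.T := right_mem_Icc.2 hab
  obtain ⟨p', hpp', heq⟩ := hp.adjoint_eq
  have hQ : ∀ t, ∃ Q : Lp (StateSpace n) 2 μ, t ∈ Icc P.t₀ P.T → Q =ᵐ[μ] q t := fun t => by
    by_cases ht : t ∈ Icc P.t₀ P.T
    · have hm : MemLp (q t) 2 μ := MemLp.of_bound (hq.meas t ht) B
        (ae_of_all _ fun ω => hq.bound ω t ht)
      exact ⟨hm.toLp, fun _ => hm.coeFn_toLp⟩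
    · exact ⟨0, fun h => absurd h ht⟩
  choose Q hQ using hQ
  set a : ℝ → Ω → StateSpace n := fun s ω =>
    -ContinuousLinearMap.adjoint (P.dynJac (x s ω) (w s) ω) (q s ω) with ha
  have habd : ∀ s ∈ Icc P.t₀ P.T, ∀ ω, ‖a s ω‖ ≤ K * B := fun s hs ω => by
    rw [norm_neg]
    exact (hb.norm_adjoint_dynJac_le (hr.control.2 _) _ _ _).trans
      (mul_le_mul_of_nonneg_left (hq.bound _ _ hs) hK)
  have hR : ∀ t, ∃ R : Lp (StateSpace n) 2 μ, t ∈ Icc P.t₀ P.T → R =ᵐ[μ] a t := fun t => by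
    by_cases ht : t ∈ Icc P.t₀ P.T
    · have hxm := h0.aestronglyMeasurable_arc hφ hr.control hr.adm t ht
      have hm' := (h0.aemeasurable_adjoint_dynJac hxm.aemeasurable (hq.meas t ht).aemeasurable
        (aemeasurable_const (b := w t)) aemeasurable_id
        (ae_of_all _ fun ω => hr.diff₀ ω ht)
        (ae_of_all _ fun ω => hr.diff₁ ω ht)).aestronglyMeasurable
      have hm : MemLp (a t) 2 μ := MemLp.of_bound hm'.neg (K * B)
        (ae_of_all _ fun ω => habd t ht ω)
      exact ⟨hm.toLp, fun _ => hm.coeFn_toLp⟩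
    · exact ⟨0, fun h => absurd h ht⟩
  choose R hR using hR
  set d : ℝ → Lp (StateSpace n) 2 μ := fun t => p t - Q t with hd
  have hQc : ContinuousOn Q (Icc P.t₀ P.T) := by
    -- Arcs of `q` are Lipschitz in time uniformly in the parameter, hence so are their `L²`
    -- classes; `|B|` supplies the nonnegativity that `B` is not assumed to have.
    set L := (measureUnivNNReal μ : ℝ) ^ ((2 : ℝ≥0∞).toReal⁻¹) * (K * |B|) with hL
    refine LipschitzOnWith.continuousOn (K := L.toNNReal)
      (LipschitzOnWith.of_dist_le_mul fun s hs t ht => ?_)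
    rw [dist_eq_norm]
    have hae : ∀ᵐ ω ∂μ, ‖(Q s - Q t) ω‖ ≤ K * |B| * dist s t := by
      filter_upwards [Lp.coeFn_sub (Q s) (Q t), hQ s hs, hQ t ht] with ω e1 e2 e3
      rw [e1, Pi.sub_apply, e2, e3]
      exact (hq.adjoint ω).norm_sub_le (fun r hr => (habd r hr ω).trans
        (mul_le_mul_of_nonneg_left (le_abs_self B) hK)) ht hs
    refine (Lp.norm_le_of_ae_bound (by positivity) hae).trans ?_
    rw [← mul_assoc]
    exact mul_le_mul_of_nonneg_right (Real.le_coe_toNNReal L) dist_nonneg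
  have hdc : ContinuousOn d (Icc P.t₀ P.T) := hpp'.continuousOn.sub hQc
  have hdT : d P.T = 0 := by
    refine sub_eq_zero.2 (Lp.ext ?_)
    filter_upwards [hp.terminal, hQ P.T hT] with ω e1 e2
    rw [e2, ← neg_inj, e1, hq.terminal ω]
  have hae : ∀ᵐ s ∂volume.restrict (Icc P.t₀ P.T), ‖p' s - R s‖ ≤ K * ‖d s‖ := by
    filter_upwards [heq, huw, ae_restrict_mem measurableSet_Icc] with s e1 e2 hs
    refine Lp.norm_le_mul_norm_of_ae_le_mul ?_
    filter_upwards [e1, hR s hs, hQ s hs, Lp.coeFn_sub (p' s) (R s), Lp.coeFn_sub (p s) (Q s)]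
      with ω f1 f2 f3 f4 f5
    rw [f4, Pi.sub_apply, f2, show d s = p s - Q s from rfl, f5, Pi.sub_apply, f3]
    rw [e2] at f1
    refine le_of_eq_of_le (congrArg norm ?_) ((norm_neg _).trans_le
      (hb.norm_adjoint_dynJac_le (hr.control.2 s) (x s ω) ω (p s ω - q s ω)))
    rw [map_sub, ← f1]
    simp only [ha]
    abel
  -- The equation for the difference is tested with the fixed element `d t`, so for `q` only scalar
  -- time integrals occur. This gives `‖d t‖²` on the left and a factor `‖d t‖` on the right, which
  -- is cancelled unless it is zero.
  have hweak : ∀ t ∈ Icc P.t₀ P.T, ‖d t‖ ≤ K * ∫ s in t..P.T, ‖d s‖ := by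
    intro t ht
    obtain ⟨i1, i2⟩ := hq.integral_inner_sub h0 hφ hr (d t) ht
    have j1 := (innerSL ℝ (d t)).intervalIntegral_comp_comm (hpp'.intervalIntegrable_sub ht hT)
    have j2 : IntervalIntegrable (fun s => inner ℝ (d t) (p' s)) volume t P.T := by
      have := hpp'.intervalIntegrable_sub ht hT
      exact ⟨(innerSL ℝ (d t)).integrable_comp this.1, (innerSL ℝ (d t)).integrable_comp this.2⟩
    simp only [innerSL_apply_apply] at j1
    rw [← hpp'.sub_eq ht hT] at j1
    have j3 : ∫ ω, inner ℝ (d t ω) (q P.T ω - q t ω) ∂μ = inner ℝ (d t) (Q P.T - Q t) := by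
      rw [L2.inner_def]
      refine integral_congr_ae ?_
      filter_upwards [Lp.coeFn_sub (Q P.T) (Q t), hQ P.T hT, hQ t ht] with ω e1 e2 e3
      rw [e1, Pi.sub_apply, e2, e3]
    have j4 : -inner ℝ (d t) (d t) = ∫ s in t..P.T, (inner ℝ (d t) (p' s) -
        ∫ ω, inner ℝ (d t ω) (a s ω) ∂μ) := by
      rw [intervalIntegral.integral_sub j2 i1, j1, ← i2, j3, ← inner_sub_right, ← inner_neg_right]
      congr 1
      have : p P.T = Q P.T := sub_eq_zero.1 hdT
      rw [this]
      simp only [hd]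
      abel
    have hdi : IntervalIntegrable (fun s => ‖d s‖) volume t P.T :=
      (hdc.norm.mono (Icc_subset_Icc_left ht.1)).intervalIntegrable_of_Icc ht.2
    have j5 : ∀ᵐ s, s ∈ Ioc t P.T → ‖inner ℝ (d t) (p' s) - ∫ ω, inner ℝ (d t ω) (a s ω) ∂μ‖ ≤
        ‖d t‖ * (K * ‖d s‖) := by
      filter_upwards [(ae_restrict_iff' measurableSet_Icc).1 hae] with s hs hst
      have hs' : s ∈ Icc P.t₀ P.T := ⟨ht.1.trans hst.1.le, hst.2⟩
      have e : ∫ ω, inner ℝ (d t ω) (a s ω) ∂μ = inner ℝ (d t) (R s) := by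
        rw [L2.inner_def]
        refine integral_congr_ae ?_
        filter_upwards [hR s hs'] with ω e1
        rw [e1]
      rw [e, ← inner_sub_right]
      exact (norm_inner_le_norm _ _).trans
        (mul_le_mul_of_nonneg_left (hs hs') (norm_nonneg _))
    have j6 := intervalIntegral.norm_integral_le_of_norm_le ht.2 j5
      ((hdi.const_mul K).const_mul ‖d t‖)
    rw [← j4, norm_neg, real_inner_self_eq_norm_sq, intervalIntegral.integral_const_mul,
      intervalIntegral.integral_const_mul, norm_pow, norm_norm, sq] at j6
    rcases (norm_nonneg (d t)).eq_or_lt with h | h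
    · rw [← h]
      exact mul_nonneg hK (intervalIntegral.integral_nonneg ht.2 fun s _ => norm_nonneg _)
    · exact le_of_mul_le_mul_left j6 h
  intro t ht
  have hrev : ∀ s ∈ Icc P.t₀ P.T, P.t₀ + P.T - s ∈ Icc P.t₀ P.T := fun s hs =>
    ⟨by linarith [hs.2], by linarith [hs.1]⟩
  -- Grönwall in reversed time with additive constant `0` forces the difference to vanish.
  have hgron := le_mul_exp_of_le_add_integral (f := fun s => ‖d (P.t₀ + P.T - s)‖) (c := 0) hK
    ((hdc.comp (by fun_prop) hrev).norm) (fun s hs => by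
      rw [zero_add, intervalIntegral.integral_comp_sub_left (fun r => ‖d r‖) (P.t₀ + P.T),
        add_sub_cancel_left]
      exact hweak _ (hrev s hs)) _ (hrev t ht)
  rw [zero_mul] at hgron
  rw [sub_sub_cancel] at hgron
  have : p t = Q t := sub_eq_zero.1 (norm_le_zero_iff.1 hgron)
  rw [this]
  exact hQ t ht

end AffineProblem

/-! ### The characterization in both cases -/

theorem mainTheorem2 {n : ℕ} {Ω : Type*} [MetricSpace Ω] [CompleteSpace Ω]
    [TopologicalSpace.SeparableSpace Ω] [MeasurableSpace Ω] [BorelSpace Ω]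
    (μ : Measure Ω) [IsProbabilityMeasure μ] (P : AffineProblem n Ω) (h0 : P.H0)
    (u : ℝ → ℝ) (x : ℝ → Ω → StateSpace n) (δ : ℝ) (hδ : 0 < δ) (h1 : P.H1 μ x δ) :
    -- known initial condition
    ((∃ x₀ : StateSpace n, ∀ ω, P.φ ω = x₀) → P.IsW11LocalMin μ u x →
      ∀ p : ℝ → Ω → StateSpace n, P.IsCostate μ u x p →
        P.ControlCharacterization μ u x p) ∧
    -- uncertain initial condition
    (MemLp P.φ 2 μ → P.IsW11LocalMinL2 μ u x →
      ∀ p : ℝ → Lp (StateSpace n) 2 μ, P.IsCostateL2 μ u x p →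
        P.ControlCharacterization μ u x (fun t ω => p t ω)) := by
  have : SecondCountableTopology Ω := UniformSpace.secondCountable_of_separable Ω
  refine ⟨fun ⟨x₀, hφ⟩ hmin p hp => ?_, fun hφ hmin p hp => ?_⟩
  · obtain ⟨w, hw, huw⟩ := hmin.1.1.exists_isStrictControl
    have hx := hmin.1.congr_control hw huw
    have hr := h1.isRegular hδ hw hx
    have hφ2 : MemLp P.φ 2 μ := by
      rw [funext hφ]
      exact memLp_const x₀
    obtain ⟨q, B, hq⟩ := AffineProblem.exists_isBoundedCostate h0 h1 hδ hφ2.1 hr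
    refine ((hmin.isUniformLocalMin h0 hφ hw hx).controlCharacterization h0 h1 hδ hφ2 hr hq).congr
      huw fun t ht => ?_
    filter_upwards [Measure.support_mem_ae] with ω hω
    exact hp.eq_of_isBoundedCostate h0 hw huw hq hω t ht
  · obtain ⟨w, hw, huw⟩ := hmin.1.1.exists_isStrictControl
    have hx := hmin.1.congr_control hw huw
    have hr := h1.isRegular hδ hw hx
    obtain ⟨q, B, hq⟩ := AffineProblem.exists_isBoundedCostate h0 h1 hδ hφ.1 hr
    exact ((hmin.isUniformLocalMin h0 hφ hw hx).controlCharacterization h0 h1 hδ hφ hr hq).congr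
      huw (hp.ae_eq_of_isBoundedCostate h0 hφ.1 hr huw hq)
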